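/- Conventions. A check stack pushdown automaton (cspda) over a finite alphabet $A$ is a nondeterministic finite-state machine with a one-way input tape, a check stack and a pushdown stack, working in two stages. In the first stage (initialisation) it reads no input and, under the control of a finite automaton, writes a word on the check stack; it then starts the second stage in some state $q$ with empty pushdown stack (an entry configuration), the words that can be written before starting in $q$ forming a regular language. In the second stage the check stack is fixed, and a move depends on the state, on at most one input letter (a reading move reads a letter, a non-reading move reads none), on the top symbol of the pushdown stack, and on the check stack symbol at the same height (if any); it changes the state and replaces the top pushdown symbol by a word (at empty pushdown stack, it pushes a word). A word is accepted if some computation enters an accepting state at some stage after reading the whole word. The languages accepted by cspda are exactly the ET0L languages. A fail state is a state from which no path of transitions leads to an accepting state. A cspda $M$ with language $L(M)$ is special if each state is either reading (only reading moves) or non-reading (only non-reading moves), there is at most one fail state, which is non-reading and has no transitions, and: (0) in the second stage, all paths of non-reading moves lead eventually to the fail state or to a reading state; (1) the second stage begins in a reading state with empty pushdown stack, and it is deterministic; (2) in the second stage the pushdown stack never becomes higher than the check stack; (3) for each entry configuration $C$ and all $u,v\in A^*$ with $v\notin L(M)$, either $C^{uv}=C^u$ or $C^{uv}$ fails. Here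 $C^w$ is the configuration in which $M$, started in $C$, enters its first reading state after reading all of $w$; $C^w$ fails if there is none. A finitely generated group $G$ is co-ET0L (special co-ET0L) if for some finite inverse-closed generating set $A$ the co-word problem, that is, the set of words over $A$ that do not represent $1_G$, is accepted by a cspda (by a special cspda). Theorem. Let $H$ be a special co-ET0L group and let $K$ be a finitely generated virtually free group. Then the restricted standard wreath product $H\wr K$, that is, the semidirect product of the group of finitely supported functions $K\to H$ by $K$ acting by translation, is a special co-ET0L group; in particular, it is a co-ET0L group. -/

import Mathlib

universe u v

/-! ### Check stack pushdown automata -/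

/-- A check stack pushdown automaton (cspda) with finite input alphabet `A`.

* `Q`, `Δ`, `Γ` are the finite sets of states, of check stack symbols and of pushdown symbols.
* `entry q` is the language of all words that the first stage (the initialisation, controlled by a
  finite state automaton) can write on the check stack when it hands over to the second stage in
  state `q`; it is regular.
* `δ q a s` is the finite set of second stage moves that are available in state `q`, where `a` is
  `some x` if the move reads the letter `x` from the input tape and `none` if it is a non-reading
  move, and `s` is what the read write head sees: `none` if it is at the bottom of the two stacks
  (the pushdown stack is empty), `some (some d, g)` if the top of the pushdown stack is `g` and `d`
  is the check stack symbol in the same position, and `some (none, g)` if the top of the pushdown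
  stack is `g` and the head is above the top of the check stack. A move `(q', w)` passes to the
  state `q'` and replaces the top symbol of the pushdown stack (if there is one) by the word `w`,
  whose first letter becomes the new top. -/
structure CSPDA (A : Type u) where
  Q : Type
  Δ : Type
  Γ : Type
  [finite_Q : Finite Q]
  [finite_Δ : Finite Δ]
  [finite_Γ : Finite Γ]
  entry : Q → Language Δ
  entry_regular : ∀ q, (entry q).IsRegular
  δ : Q → Option A → Option (Option Δ × Γ) → Set (Q × List Γ)
  δ_finite : ∀ q a s, (δ q a s).Finite
  accept : Set Q

namespace CSPDA

variable {A : Type u} (M : CSPDA A)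

/-- A configuration during the second stage: the state, the contents of the check stack (bottom
symbol first) and the contents of the pushdown stack (top symbol first). -/
@[ext]
structure Config where
  state : M.Q
  check : List M.Δ
  pushdown : List M.Γ

variable {M}

/-- What the read write head sees. A nonempty pushdown stack with `t.length` symbols below its top
is compared with the check stack symbol that has `t.length` symbols below it. -/
def Config.view (C : M.Config) : Option (Option M.Δ × M.Γ) :=
  match C.pushdown with
  | [] => none
  | g :: t => some (C.check[t.length]?, g)

variable (M)

/-- A single move of the second stage; the check stack is not altered. -/
def Step (C : M.Config) (a : Option A) (D : M.Config) : Prop :=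
  ∃ w : List M.Γ, (D.state, w) ∈ M.δ C.state a C.view ∧
    D.check = C.check ∧ D.pushdown = w ++ C.pushdown.tail

/-- `M.Run C w D`: some finite sequence of second stage moves leads from `C` to `D` and reads
exactly the word `w`. -/
inductive Run : M.Config → List A → M.Config → Prop
  | refl (C : M.Config) : Run C [] C
  | silent {C D E : M.Config} {w : List A} : M.Step C none D → Run D w E → Run C w E
  | read {C D E : M.Config} {a : A} {w : List A} :
      M.Step C (some a) D → Run D w E → Run C (a :: w) E

/-- The entry configurations: those in which the second stage can begin. -/
def IsEntry (C : M.Config) : Prop :=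
  C.check ∈ M.entry C.state ∧ C.pushdown = []

/-- A word is accepted if some computation enters an accepting state at some stage after reading
the whole word. -/
def language : Language A :=
  {w | ∃ C D : M.Config, M.IsEntry C ∧ M.Run C w D ∧ D.state ∈ M.accept}

/-- There is a transition (for some input and some stack symbols) from the first state to the
second. -/
def Edge (p q : M.Q) : Prop :=
  ∃ a s w, (q, w) ∈ M.δ p a s

/-- A fail state: there is no (possibly empty) path from it to an accepting state. -/
def IsFailState (q : M.Q) : Prop :=
  ¬ ∃ p ∈ M.accept, Relation.ReflTransGen M.Edge q p

/-- With `R` the set of reading states: all paths of non-reading moves from the configuration are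
finite, and lead to a configuration in a reading state or in a fail state. -/
inductive Settles (R : Set M.Q) : M.Config → Prop
  | reading {C : M.Config} : C.state ∈ R → Settles R C
  | fail {C : M.Config} : M.IsFailState C.state → Settles R C
  | move {C : M.Config} : (∃ D, M.Step C none D) → (∀ D, M.Step C none D → Settles R D) →
      Settles R C

/-- `M.After R C w D` says that `C ^ w = D`, for a deterministic machine with set `R` of reading
states: `D` is the configuration in which the machine, started in the reading configuration `C`,
enters a reading state after reading all of `w`. (A reading state has no non-reading moves, so this
is the first reading state that is entered after reading `w`.) -/
def After (R : Set M.Q) (C : M.Config) (w : List A) (D : M.Config) : Prop :=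
  M.Run C w D ∧ D.state ∈ R

/-- `C ^ w` fails: the machine does not reach a reading state after reading all of `w`. -/
def Fails (R : Set M.Q) (C : M.Config) (w : List A) : Prop :=
  ¬ ∃ D, M.After R C w D

/-- A special cspda, with set `R` of reading states. -/
structure IsSpecial (R : Set M.Q) : Prop where
  /-- Reading states have only reading moves. -/
  reading_moves : ∀ q ∈ R, ∀ s, M.δ q none s = ∅
  /-- All other states have only non-reading moves. -/
  silent_moves : ∀ q ∉ R, ∀ a s, M.δ q (some a) s = ∅
  /-- There is at most one fail state; it is non-reading and has no transitions. -/
  fail_unique : ∀ p q, M.IsFailState p → M.IsFailState q → p = q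
  fail_not_reading : ∀ q, M.IsFailState q → q ∉ R
  fail_halts : ∀ q, M.IsFailState q → ∀ a s, M.δ q a s = ∅
  /-- Property (0): in the second stage all paths of non-reading moves lead eventually to the fail
  state or to a reading state. -/
  settles : ∀ C D w, M.IsEntry C → M.Run C w D → M.Settles R D
  /-- Property (1), deterministic upon input: the second stage begins in a reading state (and with
  empty pushdown stack) and is deterministic. -/
  entry_reading : ∀ C, M.IsEntry C → C.state ∈ R
  deterministic : ∀ q a s, (M.δ q a s).Subsingleton
  /-- Property (2): the read write head never moves above the top of the check stack. -/
  bounded : ∀ C D w, M.IsEntry C → M.Run C w D → D.pushdown.length ≤ D.check.length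
  /-- Property (3): subwords that are not in the language are ignored, that is, `C ^ (u v) = C ^ u`
  or `C ^ (u v)` fails, for all entry configurations `C` and all `u`, `v` with `v` not in the
  language. -/
  ignores : ∀ C, M.IsEntry C → ∀ u v : List A, v ∉ M.language →
    (∃ D, M.After R C u D ∧ M.After R C (u ++ v) D) ∨ M.Fails R C (u ++ v)

end CSPDA

/-- ET0L languages, as the languages accepted by check stack pushdown automata. -/
def IsET0L {A : Type u} [Finite A] (L : Language A) : Prop :=
  ∃ M : CSPDA A, M.language = L

/-- Special ET0L languages: those accepted by a special cspda. -/
def IsSpecialET0L {A : Type u} [Finite A] (L : Language A) : Prop :=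
  ∃ (M : CSPDA A) (R : Set M.Q), M.IsSpecial R ∧ M.language = L

/-! ### Groups -/

section Groups

variable (G : Type u) [Group G]

/-- `A` is a finite inverse-closed generating set of the group `G`. -/
structure IsSymmGenerating {G : Type u} [Group G] (A : Finset G) : Prop where
  inv_mem : ∀ a ∈ A, a⁻¹ ∈ A
  closure_eq_top : Subgroup.closure (A : Set G) = ⊤

/-- The co-word problem: the words over `A` that do not represent the identity of `G`. -/
def coWordProblem {G : Type u} [Group G] (A : Finset G) : Language A :=
  {w | (w.map (fun a : A => (a : G))).prod ≠ 1}

/-- `G` is a (finitely generated) co-ET0L group. -/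
def IsCoET0L : Prop :=
  ∃ A : Finset G, IsSymmGenerating A ∧ IsET0L (coWordProblem A)

/-- `G` is a (finitely generated) special co-ET0L group. -/
def IsSpecialCoET0L : Prop :=
  ∃ A : Finset G, IsSymmGenerating A ∧ IsSpecialET0L (coWordProblem A)

/-- `G` has a free subgroup of finite index. -/
def IsVirtuallyFree : Prop :=
  ∃ F : Subgroup G, F.FiniteIndex ∧ IsFreeGroup F

/-- The restricted standard wreath product of `H` by `K`: the subgroup of the unrestricted regular
wreath product `H ≀ᵣ K` whose base group consists of the finitely supported functions `K → H`. -/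
def restrictedWreathProduct (H : Type u) (K : Type v) [Group H] [Group K] :
    Subgroup (H ≀ᵣ K) where
  carrier := {x | (Function.mulSupport x.left).Finite}
  one_mem' := by
    simp [RegularWreathProduct.one_left]
  mul_mem' := by
    intro a b ha hb
    simp only [Set.mem_ofPred_eq, RegularWreathProduct.mul_left] at *
    refine (ha.union (hb.image (fun x => a.right * x))).subset ?_
    refine (Function.mulSupport_mul _ _).trans (Set.union_subset_union_right _ ?_)
    intro x hx
    exact ⟨a.right⁻¹ * x, hx, by simp⟩
  inv_mem' := by
    intro a ha
    simp only [Set.mem_ofPred_eq, RegularWreathProduct.inv_left] at *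
    refine (ha.image (fun x => a.right⁻¹ * x)).subset ?_
    intro x hx
    refine ⟨a.right * x, ?_, by simp⟩
    simpa [Function.mem_mulSupport] using hx

end Groups

-- An element of the wreath product is nontrivial iff its `K`-component is nontrivial or one of its
-- coordinates in `H` is. Reading a word moves a position in `K`, and each coordinate is the product
-- of the letters of `H` read while the position has a certain value. So a machine guesses a target
-- position, feeds the letters read there to a special machine `M` for `H`, and accepts if `M`
-- accepts or if the position is not the identity.
--
-- A finitely generated virtually free group has a normal form: a coset representative, kept in the
-- state, and a reduced free word, kept on the pushdown stack. Positions are inverses of elements of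
-- `K`, so a generator acts on the left and changes only a bounded piece at the top of the stack.
-- The check stack carries a path `κ` to the target, a mark, a check word `d` of `M`, padding and a
-- final symbol. While `M` is in its entry configuration (outer mode), the pushdown stack holds the
-- absolute path, with flags recording agreement with `κ`. When the target is hit, `M` runs above
-- the mark, beside `d`. While `M` rests elsewhere (inner mode), the path relative to the target is
-- kept on top of its stack. As soon as `M` returns to its entry configuration, the machine returns
-- to outer mode.
--
-- This return is what gives property (3). A trivial word `v` restores the position and, since the
-- letters it adds at the target have trivial product, property (3) of `M` restores its
-- configuration; these two data determine the configuration of the new machine. `WreathInv` records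
-- the correspondence, and `WreathInv.step`, `wreath_exists_after` and `wreath_isPre` carry the
-- argument.
--
-- Two normalisations surround the construction. `IsPre` omits the conditions on fail states, which
-- `trim` restores. Before the construction, `delay` replaces `M` by a machine that accepts only in
-- reading states: after each letter it simulates a cancelling pair `y' y`, which by property (3)
-- restores the configuration, and remembers whether the original machine accepted at the end of
-- that pair.

universe w

/-! ### Runs and determinism. -/

namespace CSPDA

variable {A : Type u} {M : CSPDA A}

theorem Run.append {C D E : M.Config} {u v : List A} (h₁ : M.Run C u D) (h₂ : M.Run D v E) :
    M.Run C (u ++ v) E := by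
  induction h₁ with
  | refl C => exact h₂
  | silent hs _ ih => exact .silent hs (ih h₂)
  | read hs _ ih => exact .read hs (ih h₂)

theorem Run.single {C D : M.Config} {a : Option A} (h : M.Step C a D) :
    M.Run C a.toList D := by
  cases a with
  | none => exact .silent h (.refl D)
  | some a => exact .read h (.refl D)

theorem Run.exists_of_append {C E : M.Config} {u v : List A} (h : M.Run C (u ++ v) E) :
    ∃ D, M.Run C u D ∧ M.Run D v E := by
  generalize hw : u ++ v = w at h
  induction h generalizing u with
  | refl C =>
    obtain ⟨rfl, rfl⟩ := List.append_eq_nil_iff.1 hw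
    exact ⟨C, .refl C, .refl C⟩
  | silent hs _ ih =>
    obtain ⟨D, h₁, h₂⟩ := ih hw
    exact ⟨D, .silent hs h₁, h₂⟩
  | @read C D E a w hs hr ih =>
    cases u with
    | nil =>
      simp only [List.nil_append] at hw
      subst hw
      exact ⟨C, .refl C, .read hs hr⟩
    | cons b u =>
      simp only [List.cons_append, List.cons.injEq] at hw
      obtain ⟨rfl, hw⟩ := hw
      obtain ⟨D, h₁, h₂⟩ := ih hw
      exact ⟨D, .read hs h₁, h₂⟩

theorem Run.check_eq {C D : M.Config} {w : List A} (h : M.Run C w D) : D.check = C.check := by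
  induction h with
  | refl C => rfl
  | silent hs _ ih => obtain ⟨_, _, h, _⟩ := hs; rw [ih, h]
  | read hs _ ih => obtain ⟨_, _, h, _⟩ := hs; rw [ih, h]

/-- An invariant of configurations that keeps account of the word read so far. -/
theorem Run.invariant {P : List A → M.Config → Prop}
    (hP : ∀ w C a D, P w C → M.Step C a D → P (w ++ a.toList) D)
    {C D : M.Config} {v w : List A} (h : M.Run C w D) (hC : P v C) : P (v ++ w) D := by
  induction h generalizing v with
  | refl C => simpa using hC
  | silent hs _ ih => exact ih (by simpa using hP _ _ _ _ hC hs)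
  | read hs _ ih => simpa using ih (hP _ _ _ _ hC hs)

variable (M)

/-- Every state is reading or non-reading, and the machine is deterministic. -/
structure IsDet (R : Set M.Q) : Prop where
  reading_moves : ∀ q ∈ R, ∀ s, M.δ q none s = ∅
  silent_moves : ∀ q ∉ R, ∀ a s, M.δ q (some a) s = ∅
  deterministic : ∀ q a s, (M.δ q a s).Subsingleton

/-- A machine that is special for the language `L`, apart from the conditions on fail states. -/
structure IsPre (R : Set M.Q) (L : Language A) : Prop extends M.IsDet R where
  terminates : ∀ C D w, M.IsEntry C → M.Run C w D → Acc (fun E D => M.Step D none E) D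
  entry_reading : ∀ C, M.IsEntry C → C.state ∈ R
  bounded : ∀ C D w, M.IsEntry C → M.Run C w D → D.pushdown.length ≤ D.check.length
  ignores : ∀ C, M.IsEntry C → ∀ u v : List A, v ∉ L → ∀ D E, M.After R C u D →
    M.After R C (u ++ v) E → E = D
  language_eq : M.language = L

variable {M} {R : Set M.Q} {L : Language A}

namespace IsDet

theorem step_unique (h : M.IsDet R) {C D E : M.Config} {a : Option A} (hD : M.Step C a D)
    (hE : M.Step C a E) : D = E := by
  obtain ⟨w, h₁, h₂, h₃⟩ := hD
  obtain ⟨w', h₁', h₂', h₃'⟩ := hE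
  have := h.deterministic _ _ _ h₁ h₁'
  simp only [Prod.mk.injEq] at this
  ext1
  · exact this.1
  · rw [h₂, h₂']
  · rw [h₃, h₃', this.2]

theorem not_reading_of_step (h : M.IsDet R) {C D : M.Config} (hD : M.Step C none D) :
    C.state ∉ R := by
  obtain ⟨w, h₁, -⟩ := hD
  intro hC
  rw [h.reading_moves _ hC] at h₁
  exact h₁

theorem reading_of_step (h : M.IsDet R) {C D : M.Config} {a : A} (hD : M.Step C (some a) D) :
    C.state ∈ R := by
  obtain ⟨w, h₁, -⟩ := hD
  by_contra hC
  rw [h.silent_moves _ hC] at h₁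
  exact h₁

/-- By determinism two runs from `C` that read the same word are comparable, and a run that has
stopped in a reading state has no silent continuation. Hence the other run is an initial part of it.
-/
theorem run_continue (h : M.IsDet R) {C D E : M.Config} {w : List A} (hE : M.Run C w E)
    (hD : M.After R C w D) : M.Run E [] D := by
  obtain ⟨hD, hR⟩ := hD
  induction hE with
  | refl C => exact hD
  | silent hs _ ih =>
    cases hD with
    | refl => exact absurd hR (h.not_reading_of_step hs)
    | silent hs' hr => exact ih (h.step_unique hs hs' ▸ hr)
    | read hs' hr => exact absurd (h.reading_of_step hs') (h.not_reading_of_step hs)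
  | read hs _ ih =>
    cases hD with
    | silent hs' hr => exact absurd (h.reading_of_step hs) (h.not_reading_of_step hs')
    | read hs' hr => exact ih (h.step_unique hs hs' ▸ hr)

theorem run_nil_eq (h : M.IsDet R) {C D : M.Config} (hC : C.state ∈ R) (hD : M.Run C [] D) :
    D = C := by
  cases hD with
  | refl => rfl
  | silent hs _ => exact absurd hC (h.not_reading_of_step hs)

theorem after_unique (h : M.IsDet R) {C D E : M.Config} {w : List A}
    (hD : M.After R C w D) (hE : M.After R C w E) : E = D :=
  h.run_nil_eq hD.2 (h.run_continue hD.1 hE)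

theorem run_to_reading (h : M.IsDet R) {C E : M.Config} {w : List A} (hE : M.Run C w E)
    (hw : w ≠ [] ∨ E.state ∈ R) : ∃ D, M.After R C [] D ∧ M.Run D w E := by
  induction hE with
  | refl C => exact ⟨C, ⟨.refl C, by simpa using hw⟩, .refl C⟩
  | silent hs _ ih =>
    obtain ⟨D, ⟨h₁, h₂⟩, h₃⟩ := ih hw
    exact ⟨D, ⟨.silent hs h₁, h₂⟩, h₃⟩
  | @read C _ _ _ _ hs hr ih => exact ⟨C, ⟨.refl C, h.reading_of_step hs⟩, .read hs hr⟩

/-- Letters are read only in reading states, so a run that goes on to read a letter after `u`, or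
that itself ends in a reading state, passes through `C ^ u`. -/
theorem after_of_append (h : M.IsDet R) {C E : M.Config} {u v : List A}
    (hE : M.Run C (u ++ v) E) (hv : v ≠ [] ∨ E.state ∈ R) :
    ∃ D, M.After R C u D ∧ M.Run D v E := by
  obtain ⟨D, h₁, h₂⟩ := hE.exists_of_append
  obtain ⟨D', ⟨h₃, h₅⟩, h₄⟩ := h.run_to_reading h₂ hv
  exact ⟨D', ⟨by simpa using h₁.append h₃, h₅⟩, h₄⟩

theorem exists_step_of_after (h : M.IsDet R) {C D E : M.Config} {w : List A}
    (hE : M.Run C w E) (hD : M.After R C w D) (hR : E.state ∉ R) :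
    ∃ E', M.Step E none E' := by
  cases h.run_continue hE hD with
  | refl => exact absurd hD.2 hR
  | silent hs _ => exact ⟨_, hs⟩

theorem exists_read_of_after (h : M.IsDet R) {C D E : M.Config} {w : List A} {a : A}
    (hD : M.After R C w D) (hE : M.Run C (w ++ [a]) E) : ∃ D', M.Step D (some a) D' := by
  obtain ⟨D₁, h₁, h₂⟩ := h.after_of_append hE (.inl (by simp))
  rw [h.after_unique hD h₁] at h₂
  cases h₂ with
  | silent hs _ => exact absurd hD.2 (h.not_reading_of_step hs)
  | read hs _ => exact ⟨_, hs⟩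

end IsDet

/-- Termination of silent moves together with progress under an invariant `P`. Both constructed
machines are shown in this way to reach their next reading state. -/
theorem exists_run_nil_reading {R : Set M.Q} {P : M.Config → Prop} {C : M.Config}
    (hP : ∀ C, P C → C.state ∉ R → ∃ D, M.Step C none D ∧ P D)
    (hacc : Acc (fun E D => M.Step D none E) C) (hC : P C) :
    ∃ D, M.After R C [] D ∧ P D := by
  induction hacc with
  | intro C _ ih =>
    by_cases hR : C.state ∈ R
    · exact ⟨C, ⟨.refl C, hR⟩, hC⟩
    · obtain ⟨D, hs, hD⟩ := hP C hC hR
      obtain ⟨E, ⟨h₁, h₂⟩, h₃⟩ := ih D hs hD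
      exact ⟨E, ⟨.silent hs h₁, h₂⟩, h₃⟩

theorem Settles.acc (h : M.IsSpecial R) {C : M.Config} (hC : M.Settles R C) :
    Acc (fun E D => M.Step D none E) C := by
  induction hC with
  | reading hR =>
    refine ⟨_, ?_⟩
    rintro D ⟨w, hw, -⟩
    rw [h.reading_moves _ hR] at hw
    exact hw.elim
  | fail hF =>
    refine ⟨_, ?_⟩
    rintro D ⟨w, hw, -⟩
    rw [h.fail_halts _ hF] at hw
    exact hw.elim
  | move _ _ ih => exact ⟨_, ih⟩

/-- Since `C ^ w` is unique, property (3) amounts to an equality under the assumption that both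
configurations exist. This form does not mention failure, so machines can be built without regard to
fail states. -/
theorem IsSpecial.isPre (h : M.IsSpecial R) : M.IsPre R M.language := by
  have hdet : M.IsDet R := ⟨h.reading_moves, h.silent_moves, h.deterministic⟩
  refine ⟨hdet, fun C D w hC hD => (h.settles C D w hC hD).acc h, h.entry_reading, h.bounded,
    fun C hC u v hv D E hD hE => ?_, rfl⟩
  rcases h.ignores C hC u v hv with ⟨F, h₁, h₂⟩ | h'
  · rw [hdet.after_unique h₁ hD, hdet.after_unique h₂ hE]
  · exact absurd ⟨E, hE⟩ h'

/-! ### Restoring a unique fail state. -/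

section Trim

open Classical in
/-- The state of the trimmed machine that corresponds to `q`. -/
noncomputable def trimState (q : M.Q) : Option {q : M.Q // ¬ M.IsFailState q} :=
  if h : M.IsFailState q then none else some ⟨q, h⟩

theorem trimState_of_fail {q : M.Q} (h : M.IsFailState q) : trimState q = none := dif_pos h

theorem trimState_of_not_fail {q : M.Q} (h : ¬ M.IsFailState q) : trimState q = some ⟨q, h⟩ :=
  dif_neg h

theorem trimState_eq_some {q : M.Q} {p : {q : M.Q // ¬ M.IsFailState q}} :
    trimState q = some p ↔ q = p.1 := by
  unfold trimState
  split_ifs with h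
  · refine ⟨nofun, ?_⟩
    rintro rfl
    exact absurd h p.2
  · simp [Subtype.ext_iff]

theorem Language.isRegular_empty {T : Type} : (0 : Language T).IsRegular :=
  ⟨Unit, inferInstance, ⟨fun _ _ => (), (), ∅⟩, by ext; simp [DFA.mem_accepts]⟩

variable (M R) in
/-- The machine in which all fail states are identified with a single one, to which all blocked
silent configurations move. -/
noncomputable def trim : CSPDA A where
  Q := Option {q : M.Q // ¬ M.IsFailState q}
  Δ := M.Δ
  Γ := M.Γ
  finite_Q := haveI := M.finite_Q; inferInstance
  finite_Δ := M.finite_Δ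
  finite_Γ := M.finite_Γ
  entry q := q.elim 0 fun q => M.entry q.1
  entry_regular q := by
    cases q with
    | none => exact Language.isRegular_empty
    | some q => exact M.entry_regular q.1
  δ q a s := q.elim ∅ fun q => {p | (∃ r ∈ M.δ q.1 a s, p = (trimState r.1, r.2)) ∨
    -- A blocked non-reading configuration gets an explicit move to the fail state. Writing `[]` at
    -- most pops a symbol, so the height bound is not endangered.
    (M.δ q.1 a s = ∅ ∧ a = none ∧ q.1 ∉ R ∧ p = (none, []))}
  δ_finite q a s := by
    cases q with
    | none => exact Set.finite_empty
    | some q =>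
      refine (((M.δ_finite q.1 a s).image fun r => (trimState r.1, r.2)).union
        (Set.finite_singleton (none, []))).subset ?_
      rintro p (⟨r, hr, rfl⟩ | hp)
      · exact .inl ⟨r, hr, rfl⟩
      · exact .inr hp.2.2.2
  accept := {p | ∃ q, p = some q ∧ q.1 ∈ M.accept}

/-- The reading states of the trimmed machine. -/
def trimReading (R : Set M.Q) : Set (M.trim R).Q := {p | ∃ q, p = some q ∧ q.1 ∈ R}

theorem mem_trim_δ {q : {q : M.Q // ¬ M.IsFailState q}} {a : Option A}
    {s : Option (Option M.Δ × M.Γ)} {p : Option {q : M.Q // ¬ M.IsFailState q}} {w : List M.Γ} :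
    (p, w) ∈ (M.trim R).δ (some q) a s ↔ (∃ r ∈ M.δ q.1 a s, p = trimState r.1 ∧ w = r.2) ∨
      (M.δ q.1 a s = ∅ ∧ a = none ∧ q.1 ∉ R ∧ p = none ∧ w = []) := by
  constructor
  · rintro (⟨r, hr, h⟩ | ⟨h₁, h₂, h₃, h⟩)
    · exact .inl ⟨r, hr, (Prod.mk.inj h).1, (Prod.mk.inj h).2⟩
    · exact .inr ⟨h₁, h₂, h₃, (Prod.mk.inj h).1, (Prod.mk.inj h).2⟩
  · rintro (⟨r, hr, rfl, rfl⟩ | ⟨h₁, h₂, h₃, rfl, rfl⟩)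
    · exact .inl ⟨r, hr, rfl⟩
    · exact .inr ⟨h₁, h₂, h₃, rfl⟩

/-- The configuration of the trimmed machine that corresponds to `C`. -/
noncomputable def trimConfig (R : Set M.Q) (C : M.Config) : (M.trim R).Config :=
  ⟨trimState C.state, C.check, C.pushdown⟩

theorem trimConfig_view (C : M.Config) : (trimConfig R C).view = C.view := by
  obtain ⟨q, c, _ | ⟨g, t⟩⟩ := C <;> rfl

theorem trimConfig_state {C : M.Config} (h : ¬ M.IsFailState C.state) :
    (trimConfig R C).state = some ⟨C.state, h⟩ := trimState_of_not_fail h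

theorem IsFailState.of_edge {p q : M.Q} (hp : M.IsFailState p) (h : M.Edge p q) :
    M.IsFailState q := by
  rintro ⟨r, hr, hqr⟩
  exact hp ⟨r, hr, .head h hqr⟩

theorem IsFailState.of_run {C D : M.Config} {w : List A} (hC : M.IsFailState C.state)
    (h : M.Run C w D) : M.IsFailState D.state := by
  induction h with
  | refl C => exact hC
  | silent hs _ ih => obtain ⟨w, hw, -⟩ := hs; exact ih (hC.of_edge ⟨_, _, _, hw⟩)
  | read hs _ ih => obtain ⟨w, hw, -⟩ := hs; exact ih (hC.of_edge ⟨_, _, _, hw⟩)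

theorem trim_step {C D : M.Config} {a : Option A} (hC : ¬ M.IsFailState C.state)
    (h : M.Step C a D) : (M.trim R).Step (trimConfig R C) a (trimConfig R D) := by
  obtain ⟨w, hw, h₁, h₂⟩ := h
  refine ⟨w, ?_, h₁, h₂⟩
  rw [trimConfig_state hC, trimConfig_view]
  exact mem_trim_δ.2 (.inl ⟨_, hw, rfl, rfl⟩)

theorem exists_of_trim_step {C : M.Config} {D : (M.trim R).Config} {a : Option A}
    (h : (M.trim R).Step (trimConfig R C) a D) :
    ¬ M.IsFailState C.state ∧ ((∃ E, M.Step C a E ∧ D = trimConfig R E) ∨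
      (a = none ∧ C.state ∉ R ∧ (∀ E, ¬ M.Step C none E) ∧
        D = ⟨none, C.check, C.pushdown.tail⟩)) := by
  obtain ⟨w, hw, h₁, h₂⟩ := h
  by_cases hC : M.IsFailState C.state
  · simp only [trimConfig, trimState_of_fail hC, trim] at hw
    exact hw.elim
  refine ⟨hC, ?_⟩
  rw [trimConfig_state hC, trimConfig_view] at hw
  rcases mem_trim_δ.1 hw with ⟨p, hp, hp', rfl⟩ | ⟨hp, rfl, hp', hp'', rfl⟩
  · exact .inl ⟨⟨p.1, C.check, p.2 ++ C.pushdown.tail⟩, ⟨p.2, hp, rfl, rfl⟩,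
      CSPDA.Config.ext hp' h₁ h₂⟩
  · refine .inr ⟨rfl, hp', ?_, CSPDA.Config.ext hp'' h₁ h₂⟩
    rintro E ⟨w, hw, -⟩
    exact hp.le hw

theorem not_trim_step_none {C D : (M.trim R).Config} {a : Option A} (hC : C.state = none) :
    ¬ (M.trim R).Step C a D := by
  rintro ⟨w, hw, -⟩
  rw [hC] at hw
  exact hw

theorem trim_run {C D : M.Config} {w : List A} (h : M.Run C w D)
    (hD : ¬ M.IsFailState D.state) : (M.trim R).Run (trimConfig R C) w (trimConfig R D) := by
  have hC : ∀ {C E w}, M.Run C w E → ¬ M.IsFailState E.state → ¬ M.IsFailState C.state :=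
    fun h hE hC => hE (hC.of_run h)
  induction h with
  | refl C => exact .refl _
  | silent hs hr ih => exact .silent (trim_step (hC (.silent hs hr) hD) hs) (ih hD)
  | read hs hr ih => exact .read (trim_step (hC (.read hs hr) hD) hs) (ih hD)

/-- The new fail state has no moves, so an added move can only be the last one of a run; everything
before it is a run of `M`. In the second alternative the stacks are still those of a reachable
configuration, up to one popped symbol. -/
theorem exists_of_trim_run {C : M.Config} {D : (M.trim R).Config} {w : List A}
    (h : (M.trim R).Run (trimConfig R C) w D) :
    (∃ E, M.Run C w E ∧ D = trimConfig R E) ∨ (D.state = none ∧ ∃ E, M.Run C w E ∧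
      D.check = E.check ∧ D.pushdown = E.pushdown.tail) := by
  generalize hC : trimConfig R C = C' at h
  induction h generalizing C with
  | refl _ => exact .inl ⟨C, .refl C, hC.symm⟩
  | silent hs hr ih =>
    subst hC
    obtain ⟨-, ⟨E, hE, rfl⟩ | ⟨-, -, -, rfl⟩⟩ := exists_of_trim_step hs
    · rcases ih rfl with ⟨F, h₁, h₂⟩ | ⟨h₁, F, h₂, h₃⟩
      · exact .inl ⟨F, .silent hE h₁, h₂⟩
      · exact .inr ⟨h₁, F, .silent hE h₂, h₃⟩
    · cases hr with
      | refl => exact .inr ⟨rfl, C, .refl C, rfl, rfl⟩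
      | silent hs' _ => exact (not_trim_step_none rfl hs').elim
      | read hs' _ => exact (not_trim_step_none rfl hs').elim
  | read hs hr ih =>
    subst hC
    obtain ⟨-, ⟨E, hE, rfl⟩ | ⟨h, -⟩⟩ := exists_of_trim_step hs
    · rcases ih rfl with ⟨F, h₁, h₂⟩ | ⟨h₁, F, h₂, h₃⟩
      · exact .inl ⟨F, .read hE h₁, h₂⟩
      · exact .inr ⟨h₁, F, .read hE h₂, h₃⟩
    · cases h

theorem exists_of_trim_isEntry {C : (M.trim R).Config} (h : (M.trim R).IsEntry C) :
    ∃ D, M.IsEntry D ∧ ¬ M.IsFailState D.state ∧ C = trimConfig R D := by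
  obtain ⟨q, c, p⟩ := C
  obtain ⟨h₁, h₂⟩ := h
  cases q with
  | none => exact h₁.elim
  | some q =>
    exact ⟨⟨q.1, c, p⟩, ⟨h₁, h₂⟩, q.2, by simp [trimConfig, trimState_of_not_fail q.2]⟩

theorem mem_trimReading {q : M.Q} :
    (trimState q ∈ trimReading R) ↔ q ∈ R ∧ ¬ M.IsFailState q := by
  by_cases h : M.IsFailState q
  · simp only [trimState_of_fail h, h, not_true_eq_false, and_false, iff_false]
    rintro ⟨p, hp, -⟩
    cases hp
  · simp only [trimState_of_not_fail h, trimReading, h, not_false_eq_true, and_true]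
    constructor
    · rintro ⟨p, hp, hp'⟩
      cases hp
      exact hp'
    · exact fun hq => ⟨_, rfl, hq⟩

theorem not_isFailState_of_mem_accept {q : M.Q} (h : q ∈ M.accept) : ¬ M.IsFailState q :=
  fun hq => hq ⟨q, h, .refl⟩

/-- A path to an accepting state visits no fail state, so it survives in the trimmed machine. -/
theorem trim_isFailState {p : (M.trim R).Q} : (M.trim R).IsFailState p ↔ p = none := by
  constructor
  · intro h
    by_contra hp
    obtain ⟨⟨q, hq⟩, rfl⟩ := Option.ne_none_iff_exists'.1 hp
    refine hq fun ⟨r, hr, hqr⟩ => h ⟨some ⟨r, not_isFailState_of_mem_accept hr⟩, ⟨_, rfl, hr⟩, ?_⟩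
    clear h hp
    have hf : ∀ {p}, Relation.ReflTransGen M.Edge p r → ¬ M.IsFailState p :=
      fun hp h => h ⟨r, hr, hp⟩
    induction hqr using Relation.ReflTransGen.head_induction_on with
    | refl => exact .refl
    | @head b c hs hr' ih =>
      refine .head ?_ (ih (hf hr') ⟨r, hr, hr'⟩)
      obtain ⟨x, s, w, hw⟩ := hs
      exact ⟨x, s, w, mem_trim_δ.2 (.inl ⟨_, hw, (trimState_of_not_fail (hf hr')).symm, rfl⟩)⟩
  · rintro rfl ⟨q, ⟨q', rfl, -⟩, h⟩
    rcases h.cases_head with h | ⟨r, ⟨_, _, _, h⟩, -⟩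
    · cases h
    · exact h

theorem trim_isDet (h : M.IsDet R) : (M.trim R).IsDet (trimReading R) where
  reading_moves := by
    rintro _ ⟨q, rfl, hq⟩ s
    refine Set.eq_empty_of_forall_notMem fun ⟨p, w⟩ hp => ?_
    rcases mem_trim_δ.1 hp with ⟨r, hr, -⟩ | ⟨-, -, hq', -⟩
    · exact (h.reading_moves _ hq s).le hr
    · exact hq' hq
  silent_moves := by
    rintro (_ | q) hq a s
    · rfl
    · have : q.1 ∉ R := fun h => hq ⟨q, rfl, h⟩
      refine Set.eq_empty_of_forall_notMem fun ⟨p, w⟩ hp => ?_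
      rcases mem_trim_δ.1 hp with ⟨r, hr, -⟩ | ⟨-, ha, -⟩
      · exact (h.silent_moves _ this a s).le hr
      · cases ha
  deterministic := by
    rintro (_ | q) a s
    · exact Set.subsingleton_empty
    · rintro _ (⟨p, hp, rfl⟩ | ⟨h₁, -, -, rfl⟩) _ (⟨p', hp', rfl⟩ | ⟨h₂, -, -, rfl⟩)
      · rw [h.deterministic _ _ _ hp hp']
      · rw [h₂] at hp; exact hp.elim
      · rw [h₁] at hp'; exact hp'.elim
      · rfl

theorem exists_of_trim_after {C : M.Config} {D : (M.trim R).Config} {w : List A}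
    (h : (M.trim R).After (trimReading R) (trimConfig R C) w D) :
    ∃ E, M.After R C w E ∧ ¬ M.IsFailState E.state ∧ D = trimConfig R E := by
  obtain ⟨h₁, h₂⟩ := h
  rcases exists_of_trim_run h₁ with ⟨E, h₃, rfl⟩ | ⟨h₃, -⟩
  · exact ⟨E, ⟨h₃, (mem_trimReading.1 h₂).1⟩, (mem_trimReading.1 h₂).2, rfl⟩
  · rw [h₃] at h₂
    obtain ⟨q, hq, -⟩ := h₂
    cases hq

theorem trim_settles {C : M.Config} (h : Acc (fun E D => M.Step D none E) C) :
    (M.trim R).Settles (trimReading R) (trimConfig R C) := by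
  induction h with
  | intro C _ ih =>
    by_cases hF : M.IsFailState C.state
    · exact .fail (trim_isFailState.2 (trimState_of_fail hF))
    by_cases hR : C.state ∈ R
    · exact .reading (mem_trimReading.2 ⟨hR, hF⟩)
    refine .move ?_ ?_
    · by_cases h : ∃ E, M.Step C none E
      · obtain ⟨E, hE⟩ := h
        exact ⟨_, trim_step hF hE⟩
      · refine ⟨⟨none, C.check, C.pushdown.tail⟩, [], ?_, rfl, rfl⟩
        rw [trimConfig_state hF, trimConfig_view]
        refine mem_trim_δ.2 (.inr ⟨?_, rfl, hR, rfl, rfl⟩)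
        refine Set.eq_empty_of_forall_notMem fun p hp => h ?_
        exact ⟨⟨p.1, C.check, p.2 ++ C.pushdown.tail⟩, p.2, hp, rfl, rfl⟩
    · intro D hD
      obtain ⟨-, ⟨E, hE, rfl⟩ | ⟨-, -, -, rfl⟩⟩ := exists_of_trim_step hD
      · exact ih E hE
      · exact .fail (trim_isFailState.2 rfl)

theorem trim_language (M : CSPDA A) (R : Set M.Q) : (M.trim R).language = M.language := by
  ext w
  constructor
  · rintro ⟨C, D, hC, hr, hD⟩
    obtain ⟨C, hC', -, rfl⟩ := exists_of_trim_isEntry hC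
    obtain ⟨q, hq, hq'⟩ := hD
    rcases exists_of_trim_run hr with ⟨E, hE, rfl⟩ | ⟨h, -⟩
    · exact ⟨C, E, hC', hE, (trimState_eq_some.1 hq) ▸ hq'⟩
    · rw [h] at hq
      cases hq
  · rintro ⟨C, D, hC, hr, hD⟩
    have hD' := not_isFailState_of_mem_accept hD
    have hC' : ¬ M.IsFailState C.state := fun h => hD' (h.of_run hr)
    refine ⟨trimConfig R C, trimConfig R D, ⟨?_, hC.2⟩, trim_run hr hD', ?_⟩
    · simp only [trimConfig, trimState_of_not_fail hC', trim]
      exact hC.1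
    · exact ⟨⟨_, hD'⟩, trimState_of_not_fail hD', hD⟩

theorem IsPre.isSpecial_trim (h : M.IsPre R L) : (M.trim R).IsSpecial (trimReading R) where
  reading_moves := (trim_isDet h.toIsDet).reading_moves
  silent_moves := (trim_isDet h.toIsDet).silent_moves
  deterministic := (trim_isDet h.toIsDet).deterministic
  fail_unique p q hp hq := (trim_isFailState.1 hp).trans (trim_isFailState.1 hq).symm
  fail_not_reading := by
    rintro q hq ⟨p, rfl, -⟩
    cases trim_isFailState.1 hq
  fail_halts q hq a s := by rw [trim_isFailState.1 hq]; rfl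
  settles C D w hC hr := by
    obtain ⟨C, hC', -, rfl⟩ := exists_of_trim_isEntry hC
    rcases exists_of_trim_run hr with ⟨E, hE, rfl⟩ | ⟨h', -⟩
    · exact trim_settles (h.terminates C E w hC' hE)
    · exact .fail (trim_isFailState.2 h')
  entry_reading C hC := by
    obtain ⟨C, hC', hF, rfl⟩ := exists_of_trim_isEntry hC
    exact mem_trimReading.2 ⟨h.entry_reading C hC', hF⟩
  bounded C D w hC hr := by
    obtain ⟨C, hC', -, rfl⟩ := exists_of_trim_isEntry hC
    rcases exists_of_trim_run hr with ⟨E, hE, rfl⟩ | ⟨-, E, hE, h₁, h₂⟩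
    · exact h.bounded C E w hC' hE
    · rw [h₁, h₂]
      refine le_trans (?_ : _ ≤ E.pushdown.length) (h.bounded C E w hC' hE)
      exact List.length_tail.trans_le (Nat.sub_le _ _)
  ignores C hC u v hv := by
    obtain ⟨C, hC', -, rfl⟩ := exists_of_trim_isEntry hC
    rw [trim_language, h.language_eq] at hv
    by_cases hE : (M.trim R).Fails (trimReading R) (trimConfig R C) (u ++ v)
    · exact .inr hE
    obtain ⟨E, hE⟩ := not_not.1 hE
    obtain ⟨E', hE', hF, rfl⟩ := exists_of_trim_after hE
    -- If `C ^ (u v)` exists then so does `C ^ u`; hence the conditional form of property (3)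
    -- suffices.
    obtain ⟨D, hD, hr⟩ := h.after_of_append hE'.1 (.inr hE'.2)
    obtain rfl := h.ignores C hC' u v hv D E' hD hE'
    exact .inl ⟨_, ⟨trim_run hD.1 hF, mem_trimReading.2 ⟨hD.2, hF⟩⟩, hE⟩

end Trim

end CSPDA

theorem CSPDA.IsPre.isSpecialET0L {A : Type u} [Finite A] {M : CSPDA A} {R : Set M.Q}
    {L : Language A} (h : M.IsPre R L) : IsSpecialET0L L :=
  ⟨M.trim R, _, h.isSpecial_trim, (M.trim_language R).trans h.language_eq⟩

namespace CSPDA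

variable {A : Type u} {M : CSPDA A} {R : Set M.Q} {L : Language A}

/-- The word that leaves the top symbol of the pushdown stack unchanged. -/
def keep {Δ Γ : Type} (s : Option (Option Δ × Γ)) : List Γ := s.elim [] fun p => [p.2]

theorem keep_view (C : M.Config) : keep C.view ++ C.pushdown.tail = C.pushdown := by
  obtain ⟨q, c, _ | ⟨g, t⟩⟩ := C <;> rfl

/-! ### Acceptance in reading states only. -/

section Delay

/-- States of the machine that, after each letter, silently simulates two further letters. -/
inductive DelayState (Q : Type)
  | rest (q : Q) (b : Bool)
  | fst (q : Q)
  | snd (q : Q)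
  | trd (q : Q) (b : Bool)

instance DelayState.finite {Q : Type} [Finite Q] : Finite (DelayState Q) :=
  Finite.of_injective (β := (Q × Bool) ⊕ Q ⊕ Q ⊕ (Q × Bool))
    (fun
      | .rest q b => .inl (q, b)
      | .fst q => .inr (.inl q)
      | .snd q => .inr (.inr (.inl q))
      | .trd q b => .inr (.inr (.inr (q, b))))
    (by rintro (_ | _ | _ | _) (_ | _ | _ | _) <;> simp)

open Classical in
/-- The moves of the machine that, after each letter, silently simulates reading `y'` and `y`, and
records whether an accepting state is entered after the last letter `y`. -/
inductive DelayMove (M : CSPDA A) (R : Set M.Q) (y' y : A) : DelayState M.Q → Option A →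
    Option (Option M.Δ × M.Γ) → DelayState M.Q → List M.Γ → Prop
  | read {q b x s q' w} : (q', w) ∈ M.δ q (some x) s →
      DelayMove M R y' y (.rest q b) (some x) s (.fst q') w
  | fst_silent {q s q' w} : (q', w) ∈ M.δ q none s →
      DelayMove M R y' y (.fst q) none s (.fst q') w
  | fst_read {q s q' w} : (q', w) ∈ M.δ q (some y') s →
      DelayMove M R y' y (.fst q) none s (.snd q') w
  | snd_silent {q s q' w} : (q', w) ∈ M.δ q none s →
      DelayMove M R y' y (.snd q) none s (.snd q') w
  | snd_read {q s q' w} : (q', w) ∈ M.δ q (some y) s →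
      DelayMove M R y' y (.snd q) none s (.trd q' (decide (q' ∈ M.accept))) w
  | trd_silent {q b s q' w} : (q', w) ∈ M.δ q none s →
      DelayMove M R y' y (.trd q b) none s (.trd q' (b || decide (q' ∈ M.accept))) w
  | done {q b s} : q ∈ R → DelayMove M R y' y (.trd q b) none s (.rest q b) (keep s)

theorem DelayMove.unique (h : M.IsDet R) {y' y : A} {p a s p₁ w₁ p₂ w₂}
    (h₁ : DelayMove M R y' y p a s p₁ w₁) (h₂ : DelayMove M R y' y p a s p₂ w₂) :
    (p₁, w₁) = (p₂, w₂) := by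
  have hR : ∀ {q s r x r'}, r ∈ M.δ q none s → r' ∈ M.δ q (some x) s → False := by
    intro q s r x r' hr hr'
    by_cases hq : q ∈ R
    · exact (h.reading_moves q hq s).le hr
    · exact (h.silent_moves q hq x s).le hr'
  have hR' : ∀ {q s r}, q ∈ R → r ∈ M.δ q none s → False :=
    fun hq hr => (h.reading_moves _ hq _).le hr
  cases h₁ with
  | read h₁ =>
    cases h₂ with
    | read h₂ => cases h.deterministic _ _ _ h₁ h₂; rfl
  | fst_silent h₁ =>
    cases h₂ with
    | fst_silent h₂ => cases h.deterministic _ _ _ h₁ h₂; rfl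
    | fst_read h₂ => exact (hR h₁ h₂).elim
  | fst_read h₁ =>
    cases h₂ with
    | fst_silent h₂ => exact (hR h₂ h₁).elim
    | fst_read h₂ => cases h.deterministic _ _ _ h₁ h₂; rfl
  | snd_silent h₁ =>
    cases h₂ with
    | snd_silent h₂ => cases h.deterministic _ _ _ h₁ h₂; rfl
    | snd_read h₂ => exact (hR h₁ h₂).elim
  | snd_read h₁ =>
    cases h₂ with
    | snd_silent h₂ => exact (hR h₂ h₁).elim
    | snd_read h₂ => cases h.deterministic _ _ _ h₁ h₂; rfl
  | trd_silent h₁ =>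
    cases h₂ with
    | trd_silent h₂ => cases h.deterministic _ _ _ h₁ h₂; rfl
    | done h₂ => exact (hR' h₂ h₁).elim
  | done h₁ =>
    cases h₂ with
    | trd_silent h₂ => exact (hR' h₁ h₂).elim
    | done h₂ => rfl

/-- The machine that, after each letter, silently simulates reading `y'` and `y`. -/
def delay (M : CSPDA A) (R : Set M.Q) (y' y : A) (hM : M.IsDet R) : CSPDA A where
  Q := DelayState M.Q
  Δ := M.Δ
  Γ := M.Γ
  finite_Q := haveI := M.finite_Q; inferInstance
  finite_Δ := M.finite_Δ
  finite_Γ := M.finite_Γ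
  entry
    | .rest q false => M.entry q
    | _ => 0
  entry_regular
    | .rest q false => M.entry_regular q
    | .rest _ true | .fst _ | .snd _ | .trd _ _ => Language.isRegular_empty
  δ p a s := {r | DelayMove M R y' y p a s r.1 r.2}
  δ_finite _ _ _ := Set.Subsingleton.finite fun _ h₁ _ h₂ => DelayMove.unique hM h₁ h₂
  accept := {p | ∃ q, p = .rest q true}

variable {y' y : A} {hM : M.IsDet R}

/-- The reading states of the machine with delay. -/
def delayReading (hM : M.IsDet R) (y' y : A) : Set (M.delay R y' y hM).Q :=
  {p | ∃ q b, p = .rest q b}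

/-- The configuration with the stacks of `E`, and with the state determined by that of `E`. -/
def delayConfig (hM : M.IsDet R) (y' y : A) (k : M.Q → DelayState M.Q) (E : M.Config) :
    (M.delay R y' y hM).Config := ⟨k E.state, E.check, E.pushdown⟩

theorem delayConfig_view (k : M.Q → DelayState M.Q) (E : M.Config) :
    (delayConfig hM y' y k E).view = E.view := by
  obtain ⟨q, c, _ | ⟨g, t⟩⟩ := E <;> rfl

theorem delay_step {k : M.Q → DelayState M.Q} {E : M.Config} {a : Option A}
    {D : (M.delay R y' y hM).Config} (h : (M.delay R y' y hM).Step (delayConfig hM y' y k E) a D) :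
    ∃ w, DelayMove M R y' y (k E.state) a E.view D.state w ∧ D.check = E.check ∧
      D.pushdown = w ++ E.pushdown.tail := by
  obtain ⟨w, h₁, h₂, h₃⟩ := h
  rw [delayConfig_view] at h₁
  exact ⟨w, h₁, h₂, h₃⟩

theorem delay_step_of_move {k k' : M.Q → DelayState M.Q} {E E' : M.Config} {a a' : Option A}
    (h : M.Step E a' E') (hk : ∀ w, (E'.state, w) ∈ M.δ E.state a' E.view →
      DelayMove M R y' y (k E.state) a E.view (k' E'.state) w) :
    (M.delay R y' y hM).Step (delayConfig hM y' y k E) a (delayConfig hM y' y k' E') := by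
  obtain ⟨w, h₁, h₂, h₃⟩ := h
  refine ⟨w, ?_, h₂, h₃⟩
  rw [delayConfig_view]
  exact hk w h₁

theorem delay_step_done {b : Bool} {E : M.Config} (hE : E.state ∈ R) :
    (M.delay R y' y hM).Step (delayConfig hM y' y (.trd · b) E) none
      (delayConfig hM y' y (.rest · b) E) := by
  refine ⟨keep E.view, ?_, rfl, (keep_view E).symm⟩
  rw [delayConfig_view]
  exact .done hE

/-- The word that the machine with delay simulates when it reads `w`. -/
def delayWord (y' y : A) (w : List A) : List A := w.flatMap fun x => [x, y', y]

@[simp]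
theorem delayWord_append (u v : List A) :
    delayWord y' y (u ++ v) = delayWord y' y u ++ delayWord y' y v := List.flatMap_append

/-- The configurations that the machine with delay reaches on input `w`. -/
inductive DelayInv (hM : M.IsDet R) (y' y : A) (C : M.Config) :
    List A → (M.delay R y' y hM).Config → Prop
  | rest {w E b} : M.After R C (delayWord y' y w) E →
      (b = true ↔ ∃ D, M.Run E [y', y] D ∧ D.state ∈ M.accept) →
      DelayInv hM y' y C w (delayConfig hM y' y (.rest · b) E)
  | fst {w x E} : M.Run C (delayWord y' y w ++ [x]) E →
      DelayInv hM y' y C (w ++ [x]) (delayConfig hM y' y .fst E)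
  | snd {w x F E} : M.After R C (delayWord y' y w ++ [x]) F → M.Run F [y'] E →
      DelayInv hM y' y C (w ++ [x]) (delayConfig hM y' y .snd E)
  | trd {w x F E b} : M.After R C (delayWord y' y w ++ [x]) F → M.Run F [y', y] E →
      (b = true → ∃ D, M.Run F [y', y] D ∧ D.state ∈ M.accept) →
      -- With a false flag, any accepting configuration still lies ahead on the silent path. In a
      -- reading state nothing lies ahead, so there the flag becomes exact.
      (b = false → ∀ D, M.Run F [y', y] D → D.state ∈ M.accept →
        ∃ E', M.Step E none E' ∧ M.Run E' [] D) →
      DelayInv hM y' y C (w ++ [x]) (delayConfig hM y' y (.trd · b) E)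

variable (hL : ∀ u v, u ++ y' :: y :: v ∈ L ↔ u ++ v ∈ L) (hnil : [] ∉ L)

include hL in
theorem delayWord_mem_iff (u v : List A) : u ++ delayWord y' y v ∈ L ↔ u ++ v ∈ L := by
  induction v generalizing u with
  | nil => rfl
  | cons x v ih =>
    have : u ++ delayWord y' y (x :: v) = (u ++ [x]) ++ y' :: y :: delayWord y' y v := by
      simp [delayWord]
    rw [this, hL, ih]
    simp

/-- Extending a run by a step. -/
theorem Run.step {C D E : M.Config} {w : List A} {a : Option A} (h : M.Run C w D)
    (hs : M.Step D a E) : M.Run C (w ++ a.toList) E := h.append (.single hs)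

theorem IsDet.run_snoc_cases (hM : M.IsDet R) {C D E : M.Config} {w : List A} {x : A}
    (hD : M.After R C w D) (hE : M.Run C (w ++ [x]) E) : M.Run D [x] E := by
  obtain ⟨D', h₁, h₂⟩ := hM.after_of_append hE (.inl (by simp))
  rwa [hM.after_unique hD h₁] at h₂

theorem IsDet.run_cases_read (hM : M.IsDet R) {C D E : M.Config} {x : A} {w : List A}
    (hD : M.Step C (some x) D) (hE : M.Run C (x :: w) E) : M.Run D w E := by
  cases hE with
  | silent hs hr => exact absurd (hM.reading_of_step hD) (hM.not_reading_of_step hs)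
  | read hs hr => exact hM.step_unique hs hD ▸ hr

theorem DelayMove.of_rest {q b a s p w} (h : DelayMove M R y' y (.rest q b) a s p w) :
    ∃ x q', a = some x ∧ p = .fst q' ∧ (q', w) ∈ M.δ q (some x) s := by
  cases h with
  | read h => exact ⟨_, _, rfl, rfl, h⟩

theorem DelayMove.of_fst {q a s p w} (h : DelayMove M R y' y (.fst q) a s p w) :
    a = none ∧ ((∃ q', p = .fst q' ∧ (q', w) ∈ M.δ q none s) ∨
      (∃ q', p = .snd q' ∧ (q', w) ∈ M.δ q (some y') s)) := by
  cases h with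
  | fst_silent h => exact ⟨rfl, .inl ⟨_, rfl, h⟩⟩
  | fst_read h => exact ⟨rfl, .inr ⟨_, rfl, h⟩⟩

open Classical in
theorem DelayMove.of_snd {q a s p w} (h : DelayMove M R y' y (.snd q) a s p w) :
    a = none ∧ ((∃ q', p = .snd q' ∧ (q', w) ∈ M.δ q none s) ∨
      (∃ q', p = .trd q' (decide (q' ∈ M.accept)) ∧ (q', w) ∈ M.δ q (some y) s)) := by
  cases h with
  | snd_silent h => exact ⟨rfl, .inl ⟨_, rfl, h⟩⟩
  | snd_read h => exact ⟨rfl, .inr ⟨_, rfl, h⟩⟩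

open Classical in
theorem DelayMove.of_trd {q b a s p w} (h : DelayMove M R y' y (.trd q b) a s p w) :
    a = none ∧ ((∃ q', p = .trd q' (b || decide (q' ∈ M.accept)) ∧ (q', w) ∈ M.δ q none s) ∨
      (q ∈ R ∧ p = .rest q b ∧ w = keep s)) := by
  cases h with
  | trd_silent h => exact ⟨rfl, .inl ⟨_, rfl, h⟩⟩
  | done h => exact ⟨rfl, .inr ⟨h, rfl, rfl⟩⟩

/-- The possible moves of the machine with delay, in terms of those of the original machine. -/
theorem delay_config_of_step {k : M.Q → DelayState M.Q} {E : M.Config} {a : Option A} {q : M.Q}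
    {w : List M.Γ} {D : (M.delay R y' y hM).Config} (hq : (q, w) ∈ M.δ E.state a E.view)
    (h₁ : D.state = k q) (h₂ : D.check = E.check) (h₃ : D.pushdown = w ++ E.pushdown.tail) :
    ∃ E', M.Step E a E' ∧ E'.state = q ∧ D = delayConfig hM y' y k E' :=
  ⟨⟨q, E.check, w ++ E.pushdown.tail⟩, ⟨w, hq, rfl, rfl⟩, rfl, CSPDA.Config.ext h₁ h₂ h₃⟩

theorem delay_step_rest {b : Bool} {E : M.Config} {a : Option A}
    {D : (M.delay R y' y hM).Config}
    (h : (M.delay R y' y hM).Step (delayConfig hM y' y (.rest · b) E) a D) :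
    ∃ x E', a = some x ∧ M.Step E (some x) E' ∧ D = delayConfig hM y' y .fst E' := by
  obtain ⟨w, h₁, h₂, h₃⟩ := delay_step h
  obtain ⟨x, q', rfl, hq, hw⟩ := h₁.of_rest
  obtain ⟨E', hs, -, rfl⟩ := delay_config_of_step hw hq h₂ h₃
  exact ⟨x, E', rfl, hs, rfl⟩

theorem delay_step_fst {E : M.Config} {a : Option A} {D : (M.delay R y' y hM).Config}
    (h : (M.delay R y' y hM).Step (delayConfig hM y' y .fst E) a D) :
    a = none ∧ ∃ E', (M.Step E none E' ∧ D = delayConfig hM y' y .fst E') ∨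
      (M.Step E (some y') E' ∧ D = delayConfig hM y' y .snd E') := by
  obtain ⟨w, h₁, h₂, h₃⟩ := delay_step h
  obtain ⟨rfl, ⟨q', hq, hw⟩ | ⟨q', hq, hw⟩⟩ := h₁.of_fst
  · obtain ⟨E', hs, -, rfl⟩ := delay_config_of_step hw hq h₂ h₃
    exact ⟨rfl, E', .inl ⟨hs, rfl⟩⟩
  · obtain ⟨E', hs, -, rfl⟩ := delay_config_of_step hw hq h₂ h₃
    exact ⟨rfl, E', .inr ⟨hs, rfl⟩⟩

open Classical in
theorem delay_step_snd {E : M.Config} {a : Option A} {D : (M.delay R y' y hM).Config}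
    (h : (M.delay R y' y hM).Step (delayConfig hM y' y .snd E) a D) :
    a = none ∧ ∃ E', (M.Step E none E' ∧ D = delayConfig hM y' y .snd E') ∨
      (M.Step E (some y) E' ∧
        D = delayConfig hM y' y (.trd · (decide (E'.state ∈ M.accept))) E') := by
  obtain ⟨w, h₁, h₂, h₃⟩ := delay_step h
  obtain ⟨rfl, ⟨q', hq, hw⟩ | ⟨q', hq, hw⟩⟩ := h₁.of_snd
  · obtain ⟨E', hs, -, rfl⟩ := delay_config_of_step hw hq h₂ h₃
    exact ⟨rfl, E', .inl ⟨hs, rfl⟩⟩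
  · obtain ⟨E', hs, rfl, rfl⟩ :=
      delay_config_of_step (k := (.trd · (decide (q' ∈ M.accept)))) hw hq h₂ h₃
    exact ⟨rfl, E', .inr ⟨hs, rfl⟩⟩

open Classical in
theorem delay_step_trd {b : Bool} {E : M.Config} {a : Option A}
    {D : (M.delay R y' y hM).Config}
    (h : (M.delay R y' y hM).Step (delayConfig hM y' y (.trd · b) E) a D) :
    a = none ∧ ((∃ E', M.Step E none E' ∧
        D = delayConfig hM y' y (.trd · (b || decide (E'.state ∈ M.accept))) E') ∨
      (E.state ∈ R ∧ D = delayConfig hM y' y (.rest · b) E)) := by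
  obtain ⟨w, h₁, h₂, h₃⟩ := delay_step h
  obtain ⟨rfl, ⟨q', hq, hw⟩ | ⟨hR, hq, rfl⟩⟩ := h₁.of_trd
  · obtain ⟨E', hs, rfl, rfl⟩ :=
      delay_config_of_step (k := (.trd · (b || decide (q' ∈ M.accept)))) hw hq h₂ h₃
    exact ⟨rfl, .inl ⟨E', hs, rfl⟩⟩
  · exact ⟨rfl, .inr ⟨hR, CSPDA.Config.ext hq h₂ (h₃.trans (keep_view E))⟩⟩

variable {C : M.Config}

include hL hnil in
theorem DelayInv.step (hP : M.IsPre R L) (hC : M.IsEntry C) {w : List A}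
    {D D' : (M.delay R y' y hM).Config} {a : Option A} (h : DelayInv hM y' y C w D)
    (hs : (M.delay R y' y hM).Step D a D') : DelayInv hM y' y C (w ++ a.toList) D' := by
  have hyy : [y', y] ∉ L := fun h' => hnil (by simpa using (hL [] []).1 h')
  cases h with
  | rest hE hb =>
    obtain ⟨x, E', rfl, hs', rfl⟩ := delay_step_rest hs
    exact .fst (hE.1.step hs')
  | fst hE =>
    obtain ⟨rfl, E', ⟨hs', rfl⟩ | ⟨hs', rfl⟩⟩ := delay_step_fst hs
    · simpa using DelayInv.fst (by simpa using hE.step hs')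
    · simpa using DelayInv.snd ⟨hE, hM.reading_of_step hs'⟩ (.single hs')
  | snd hF hE =>
    obtain ⟨rfl, E', ⟨hs', rfl⟩ | ⟨hs', rfl⟩⟩ := delay_step_snd hs
    · simpa using DelayInv.snd hF (by simpa using hE.step hs')
    · simp only [Option.toList_none, List.append_nil]
      refine DelayInv.trd hF (hE.step hs') (fun hb => ?_) (fun hb D hD hD' => ?_)
      · exact ⟨E', hE.step hs', by simpa using hb⟩
      · have h₁ : M.Run _ ([y'] ++ [y]) D := hD
        have h₂ := hM.run_cases_read hs'
          (hM.run_snoc_cases ⟨hE, hM.reading_of_step hs'⟩ h₁)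
        cases h₂ with
        | refl => exact absurd hD' (by simpa using hb)
        | silent h₃ h₄ => exact ⟨_, h₃, h₄⟩
  | trd hF hE hb hb' =>
    obtain ⟨rfl, ⟨E', hs', rfl⟩ | ⟨hR, rfl⟩⟩ := delay_step_trd hs
    · simp only [Option.toList_none, List.append_nil]
      refine DelayInv.trd hF (by simpa using hE.step hs') (fun hb₁ => ?_)
        (fun hb₁ D hD hD' => ?_)
      · rcases Bool.or_eq_true_iff.1 hb₁ with h | h
        · exact hb h
        · exact ⟨E', by simpa using hE.step hs', by simpa using h⟩
      · simp only [Bool.or_eq_false_iff, decide_eq_false_iff_not] at hb₁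
        obtain ⟨E'', h₁, h₂⟩ := hb' hb₁.1 D hD hD'
        rw [hM.step_unique h₁ hs'] at h₂
        cases h₂ with
        | refl => exact absurd hD' hb₁.2
        | silent h₃ h₄ => exact ⟨_, h₃, h₄⟩
    -- Since `[y', y]` is not in `L`, property (3) of `M` says that the simulated pair has led back
    -- to the configuration before it. So the flag obtained from this pair also answers whether a
    -- further pair would lead to acceptance.
    · have h₁ := hP.ignores C hC _ _ hyy _ _ hF ⟨hF.1.append hE, hR⟩
      subst h₁
      simp only [Option.toList_none, List.append_nil]
      refine DelayInv.rest ?_ ?_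
      · exact ⟨by simpa [delayWord] using hF.1.append hE, hR⟩
      · rename_i b
        cases b with
        | true => exact ⟨hb, fun _ => rfl⟩
        | false =>
          refine ⟨nofun, ?_⟩
          rintro ⟨D, hD, hD'⟩
          obtain ⟨E', h₂, -⟩ := hb' rfl D hD hD'
          exact absurd hR (hM.not_reading_of_step h₂)

theorem delay_isDet : (M.delay R y' y hM).IsDet (delayReading hM y' y) where
  reading_moves := by
    rintro _ ⟨q, b, rfl⟩ s
    refine Set.eq_empty_of_forall_notMem fun ⟨p, w⟩ hp => ?_
    have hp : DelayMove M R y' y _ _ s p w := hp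
    cases hp
  silent_moves := by
    rintro p hp a s
    refine Set.eq_empty_of_forall_notMem fun ⟨p', w⟩ hp' => ?_
    have hp' : DelayMove M R y' y p _ s p' w := hp'
    cases hp'
    exact hp ⟨_, _, rfl⟩
  deterministic _ _ _ _ h₁ _ h₂ := DelayMove.unique hM h₁ h₂

theorem delay_isEntry {C : (M.delay R y' y hM).Config} (h : (M.delay R y' y hM).IsEntry C) :
    ∃ E, M.IsEntry E ∧ C = delayConfig hM y' y (.rest · false) E := by
  obtain ⟨q, c, p⟩ := C
  obtain ⟨h₁, h₂⟩ := h
  match q, h₁ with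
  | .rest q false, h₁ => exact ⟨⟨q, c, p⟩, ⟨h₁, h₂⟩, rfl⟩
  | .rest _ true, h₁ => exact h₁.elim
  | .fst _, h₁ => exact h₁.elim
  | .snd _, h₁ => exact h₁.elim
  | .trd _ _, h₁ => exact h₁.elim

include hL hnil in
theorem DelayInv.start (hP : M.IsPre R L) (hC : M.IsEntry C) :
    DelayInv hM y' y C [] (delayConfig hM y' y (.rest · false) C) := by
  refine .rest ⟨.refl C, hP.entry_reading C hC⟩ ⟨nofun, ?_⟩
  rintro ⟨D, hD, hD'⟩
  have : [y', y] ∈ L := hP.language_eq ▸ ⟨C, D, hC, hD, hD'⟩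
  exact (hnil (by simpa using (hL [] []).1 this)).elim

include hL hnil in
theorem DelayInv.of_run (hP : M.IsPre R L) (hC : M.IsEntry C) {w : List A}
    {D : (M.delay R y' y hM).Config}
    (h : (M.delay R y' y hM).Run (delayConfig hM y' y (.rest · false) C) w D) :
    DelayInv hM y' y C w D := by
  simpa using h.invariant (fun w C' a D hC' hD => DelayInv.step hL hnil hP hC hC' hD)
    (DelayInv.start hL hnil hP hC)

theorem delay_acc_rest {b : Bool} {E : M.Config} :
    Acc (fun E D => (M.delay R y' y hM).Step D none E) (delayConfig hM y' y (.rest · b) E) := by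
  refine ⟨_, fun D hD => ?_⟩
  obtain ⟨x, _, h, -⟩ := delay_step_rest hD
  cases h

theorem delay_acc_trd {E : M.Config} (h : Acc (fun E D => M.Step D none E) E) (b : Bool) :
    Acc (fun E D => (M.delay R y' y hM).Step D none E) (delayConfig hM y' y (.trd · b) E) := by
  induction h generalizing b with
  | intro E _ ih =>
    refine ⟨_, fun D hD => ?_⟩
    obtain ⟨-, ⟨E', hs', rfl⟩ | ⟨-, rfl⟩⟩ := delay_step_trd hD
    · exact ih _ hs' _
    · exact delay_acc_rest

theorem delay_acc_snd {E : M.Config}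
    (h : ∀ w D, M.Run E w D → Acc (fun E D => M.Step D none E) D) :
    Acc (fun E D => (M.delay R y' y hM).Step D none E) (delayConfig hM y' y .snd E) := by
  induction h [] E (.refl E) with
  | intro E _ ih =>
    refine ⟨_, fun D hD => ?_⟩
    obtain ⟨-, E', ⟨hs', rfl⟩ | ⟨hs', rfl⟩⟩ := delay_step_snd hD
    · exact ih _ hs' fun w D hr => h w D (.silent hs' hr)
    · exact delay_acc_trd (h _ _ (.single hs')) _

theorem delay_acc_fst {E : M.Config}
    (h : ∀ w D, M.Run E w D → Acc (fun E D => M.Step D none E) D) :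
    Acc (fun E D => (M.delay R y' y hM).Step D none E) (delayConfig hM y' y .fst E) := by
  induction h [] E (.refl E) with
  | intro E _ ih =>
    refine ⟨_, fun D hD => ?_⟩
    obtain ⟨-, E', ⟨hs', rfl⟩ | ⟨hs', rfl⟩⟩ := delay_step_fst hD
    · exact ih _ hs' fun w D hr => h w D (.silent hs' hr)
    · exact delay_acc_snd fun w D hr => h _ D (.read hs' hr)

theorem DelayInv.exists_run {w : List A} {D : (M.delay R y' y hM).Config}
    (h : DelayInv hM y' y C w D) :
    ∃ v E, M.Run C v E ∧ D.check = E.check ∧ D.pushdown = E.pushdown := by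
  cases h with
  | rest hE _ => exact ⟨_, _, hE.1, rfl, rfl⟩
  | fst hE => exact ⟨_, _, hE, rfl, rfl⟩
  | snd hF hE => exact ⟨_, _, hF.1.append hE, rfl, rfl⟩
  | trd hF hE _ _ => exact ⟨_, _, hF.1.append hE, rfl, rfl⟩

theorem DelayInv.acc (hP : M.IsPre R L) (hC : M.IsEntry C) {w : List A}
    {D : (M.delay R y' y hM).Config} (h : DelayInv hM y' y C w D) :
    Acc (fun E D => (M.delay R y' y hM).Step D none E) D := by
  have key : ∀ {v E}, M.Run C v E →
      ∀ w D, M.Run E w D → Acc (fun E D => M.Step D none E) D :=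
    fun hE w D hD => hP.terminates C D _ hC (hE.append hD)
  cases h with
  | rest => exact delay_acc_rest
  | fst hE => exact delay_acc_fst (key hE)
  | snd hF hE => exact delay_acc_snd (key (hF.1.append hE))
  | trd hF hE _ _ => exact delay_acc_trd (hP.terminates C _ _ hC (hF.1.append hE)) _

theorem DelayInv.of_reading {w : List A} {D : (M.delay R y' y hM).Config}
    (h : DelayInv hM y' y C w D) (hD : D.state ∈ delayReading hM y' y) :
    ∃ E b, D = delayConfig hM y' y (.rest · b) E ∧ M.After R C (delayWord y' y w) E ∧
      (b = true ↔ ∃ D, M.Run E [y', y] D ∧ D.state ∈ M.accept) := by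
  obtain ⟨q, b, hq⟩ := hD
  cases h with
  | rest h₁ h₂ => exact ⟨_, _, rfl, h₁, h₂⟩
  | fst hE => cases hq
  | snd hF hE => cases hq
  | trd hF hE _ _ => cases hq

open Classical in
include hL hnil in
-- The run of `M` on `delayWord y' y w` dictates every move: wherever the simulation stands, that
-- run still has to continue, either silently or by the letter due next.
theorem delay_exists_after (hP : M.IsPre R L) (hC : M.IsEntry C) {w : List A}
    (hw : ∃ E, M.After R C (delayWord y' y w) E) :
    ∃ D, (M.delay R y' y hM).After (delayReading hM y' y)
      (delayConfig hM y' y (.rest · false) C) w D := by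
  induction w using List.reverseRecOn with
  | nil => exact ⟨_, .refl _, _, _, rfl⟩
  | append_singleton w x ih =>
    obtain ⟨E, hE⟩ := hw
    have hw' : delayWord y' y (w ++ [x]) = delayWord y' y w ++ [x, y', y] := by simp [delayWord]
    rw [hw'] at hE
    obtain ⟨E₀, hE₀, hr₀⟩ := hM.after_of_append hE.1 (.inl (by simp))
    obtain ⟨D₀, hD₀⟩ := ih ⟨E₀, hE₀⟩
    obtain ⟨E₁, b, rfl, hE₁, -⟩ := (DelayInv.of_run hL hnil hP hC hD₀.1).of_reading hD₀.2
    obtain rfl := hM.after_unique hE₀ hE₁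
    obtain ⟨F, hs⟩ : ∃ F, M.Step E₁ (some x) F := by
      cases hr₀ with
      | silent hs _ => exact absurd hE₀.2 (hM.not_reading_of_step hs)
      | read hs _ => exact ⟨_, hs⟩
    have hs' : (M.delay R y' y hM).Step (delayConfig hM y' y (.rest · b) E₁) (some x)
        (delayConfig hM y' y .fst F) := delay_step_of_move hs fun w hw => .read hw
    have hrun := hD₀.1.step hs'
    have hinv := DelayInv.of_run hL hnil hP hC hrun
    suffices h : _ by
      obtain ⟨D, hD, -⟩ := exists_run_nil_reading (R := delayReading hM y' y)
        (P := DelayInv hM y' y C (w ++ [x])) h (hinv.acc hP hC) hinv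
      exact ⟨D, by simpa using hrun.append hD.1, hD.2⟩
    intro D hD hR
    suffices ∃ D', (M.delay R y' y hM).Step D none D' by
      obtain ⟨D', hD'⟩ := this
      exact ⟨D', hD', by simpa using hD.step hL hnil hP hC hD'⟩
    generalize hv : w ++ [x] = v at hD
    cases hD with
    | rest => exact absurd ⟨_, _, rfl⟩ hR
    | @fst w' x' F hF =>
      obtain ⟨rfl, rfl⟩ := List.append_inj' hv rfl |>.imp_right (by simpa using ·)
      obtain ⟨G, hG, hr⟩ := hM.after_of_append (u := delayWord y' y w ++ [x]) (v := [y', y])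
        (by simpa using hE.1) (.inl (by simp))
      have := hM.run_continue hF hG
      by_cases hFR : F.state ∈ R
      · obtain rfl := hM.run_nil_eq hFR this
        cases hr with
        | silent hs _ => exact absurd hFR (hM.not_reading_of_step hs)
        | read hs _ => exact ⟨_, delay_step_of_move hs fun w hw => .fst_read hw⟩
      · obtain ⟨F', hs⟩ := hM.exists_step_of_after hF hG hFR
        exact ⟨_, delay_step_of_move hs fun w hw => .fst_silent hw⟩
    | @snd w' x' F' F hF' hF =>
      obtain ⟨rfl, rfl⟩ := List.append_inj' hv rfl |>.imp_right (by simpa using ·)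
      have hF := hF'.1.append hF
      obtain ⟨G, hG, hr⟩ := hM.after_of_append (u := delayWord y' y w ++ [x] ++ [y']) (v := [y])
        (by simpa using hE.1) (.inl (by simp))
      have := hM.run_continue hF hG
      by_cases hFR : F.state ∈ R
      · obtain rfl := hM.run_nil_eq hFR this
        cases hr with
        | silent hs _ => exact absurd hFR (hM.not_reading_of_step hs)
        | @read _ F' _ _ _ hs _ =>
          exact ⟨_, delay_step_of_move (k' := (.trd · (decide (F'.state ∈ M.accept)))) hs
            fun w hw => .snd_read hw⟩
      · obtain ⟨F', hs⟩ := hM.exists_step_of_after hF hG hFR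
        exact ⟨_, delay_step_of_move hs fun w hw => .snd_silent hw⟩
    | @trd w' x' F' F b hF' hF _ _ =>
      obtain ⟨rfl, rfl⟩ := List.append_inj' hv rfl |>.imp_right (by simpa using ·)
      by_cases hFR : F.state ∈ R
      · exact ⟨_, delay_step_done hFR⟩
      · obtain ⟨F', hs⟩ := hM.exists_step_of_after (hF'.1.append hF) (by simpa using hE) hFR
        exact ⟨_, delay_step_of_move (k' := (.trd · (b || decide (F'.state ∈ M.accept)))) hs
          fun w hw => .trd_silent hw⟩

include hL hnil in
-- Cancelling pairs do not affect membership in `L`, so `w` belongs to `L` iff the simulated word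
-- followed by one more pair does, and this is what the flag records.
theorem delay_isPre (hP : M.IsPre R L) :
    (M.delay R y' y hM).IsPre (delayReading hM y' y) L where
  toIsDet := delay_isDet
  terminates C D w hC hr := by
    obtain ⟨C, hC', rfl⟩ := delay_isEntry hC
    exact (DelayInv.of_run hL hnil hP hC' hr).acc hP hC'
  entry_reading C hC := by
    obtain ⟨C, hC', rfl⟩ := delay_isEntry hC
    exact ⟨_, _, rfl⟩
  bounded C D w hC hr := by
    obtain ⟨C, hC', rfl⟩ := delay_isEntry hC
    obtain ⟨v, E, h₁, h₂, h₃⟩ := (DelayInv.of_run hL hnil hP hC' hr).exists_run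
    rw [h₂, h₃]
    exact hP.bounded C E v hC' h₁
  ignores C hC u v hv D E hD hE := by
    obtain ⟨C, hC', rfl⟩ := delay_isEntry hC
    obtain ⟨D, b, rfl, hD₁, hb⟩ := (DelayInv.of_run hL hnil hP hC' hD.1).of_reading hD.2
    obtain ⟨E, b', rfl, hE₁, hb'⟩ := (DelayInv.of_run hL hnil hP hC' hE.1).of_reading hE.2
    rw [delayWord_append] at hE₁
    have hv' : delayWord y' y v ∉ L := fun h => hv (by simpa using (delayWord_mem_iff hL [] v).1 h)
    obtain rfl := hP.ignores C hC' _ _ hv' D E hD₁ hE₁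
    rw [Bool.eq_iff_iff.2 (hb.trans hb'.symm)]
  language_eq := by
    ext w
    have hw' : delayWord y' y w ++ [y', y] ∈ L ↔ w ∈ L := by
      rw [hL (delayWord y' y w) []]
      simpa using delayWord_mem_iff hL [] w
    constructor
    · rintro ⟨C, D, hC, hr, q, hq⟩
      obtain ⟨C, hC', rfl⟩ := delay_isEntry hC
      obtain ⟨D, b, rfl, hD₁, hb⟩ := (DelayInv.of_run hL hnil hP hC' hr).of_reading ⟨q, _, hq⟩
      obtain ⟨E, hE, hE'⟩ := hb.1 (DelayState.rest.inj hq).2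
      exact hw'.1 (hP.language_eq ▸ ⟨C, E, hC', hD₁.1.append hE, hE'⟩)
    · intro hw
      have h₁ := hw'.2 hw
      rw [← hP.language_eq] at h₁
      obtain ⟨C, D, hC, hr, hD⟩ := h₁
      -- The extra pair is used here: having to read it forces `M` into a reading state after the
      -- simulated word, even if `M` would accept the word itself only in a non-reading state.
      obtain ⟨E, hE, hr'⟩ := hM.after_of_append hr (.inl (by simp))
      obtain ⟨D', hD'⟩ := delay_exists_after (hM := hM) hL hnil hP hC ⟨E, hE⟩
      obtain ⟨E', b, rfl, hE', hb⟩ := (DelayInv.of_run hL hnil hP hC hD'.1).of_reading hD'.2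
      obtain rfl := hM.after_unique hE hE'
      obtain rfl := hb.2 ⟨D, hr', hD⟩
      exact ⟨delayConfig hM y' y (.rest · false) C, _, ⟨hC.1, hC.2⟩, hD'.1, _, rfl⟩

end Delay

/-- A machine without entry configurations. -/
def noEntry (A : Type u) : CSPDA A where
  Q := Unit
  Δ := Unit
  Γ := Unit
  entry _ := 0
  entry_regular _ := Language.isRegular_empty
  δ _ _ _ := ∅
  δ_finite _ _ _ := Set.finite_empty
  accept := ∅

theorem noEntry_isPre (A : Type u) : (noEntry A).IsPre Set.univ 0 where
  reading_moves _ _ _ := rfl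
  silent_moves _ _ _ _ := rfl
  deterministic _ _ _ := Set.subsingleton_empty
  terminates _ _ _ hC := hC.1.elim
  entry_reading _ hC := hC.1.elim
  bounded _ _ _ hC := hC.1.elim
  ignores _ hC := hC.1.elim
  language_eq := by
    ext w
    exact ⟨fun ⟨_, _, hC, _⟩ => hC.1.elim, fun h => h.elim⟩

/-- The machine for the wreath product accepts by looking at the given machine at rest, so
acceptance must be visible in reading states. Any generator with its inverse serves as cancelling
pair; without generators the co-word problem is empty. -/
theorem IsPre.exists_accept_subset {H : Type u} [Group H] {A : Finset H}
    (hA : ∀ a ∈ A, a⁻¹ ∈ A) {M : CSPDA A} {R : Set M.Q} (h : M.IsPre R (coWordProblem A)) :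
    ∃ (N : CSPDA A) (S : Set N.Q), N.IsPre S (coWordProblem A) ∧ N.accept ⊆ S := by
  rcases A.eq_empty_or_nonempty with rfl | ⟨y, hy⟩
  · refine ⟨noEntry _, Set.univ, ?_, Set.subset_univ _⟩
    suffices hw : coWordProblem (∅ : Finset H) = 0 from hw ▸ noEntry_isPre _
    ext w
    refine ⟨fun hw => ?_, fun h => h.elim⟩
    cases w with
    | nil => exact absurd rfl hw
    | cons x _ => exact absurd x.2 (Finset.notMem_empty _)
  · refine ⟨M.delay R ⟨y⁻¹, hA y hy⟩ ⟨y, hy⟩ h.toIsDet, _, delay_isPre ?_ ?_ h, ?_⟩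
    · intro u v
      change (_ ≠ _) ↔ (_ ≠ _)
      simp
    · exact fun h => h rfl
    · rintro p ⟨q, rfl⟩
      exact ⟨_, _, rfl⟩

end CSPDA

/-! ### The regular language of check stacks. -/

namespace CSPDA

/-- Check stack symbols of the machine for the wreath product. -/
inductive CheckSym (X Δ : Type)
  | pos (x : X)
  | mark
  | sym (d : Δ)
  | pad
  | halt

instance CheckSym.finite {X Δ : Type} [Finite X] [Finite Δ] : Finite (CheckSym X Δ) :=
  Finite.of_injective (β := X ⊕ Δ ⊕ Fin 3)
    (fun
      | .pos x => .inl x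
      | .sym d => .inr (.inl d)
      | .mark => .inr (.inr 0)
      | .pad => .inr (.inr 1)
      | .halt => .inr (.inr 2))
    (by rintro (_ | _ | _ | _) (_ | _ | _ | _) <;> simp)

/-- The check stack that consists of a path, a word over `Δ` and `n` symbols of padding. -/
def checkWord {X Δ : Type} (κ : List X) (d : List Δ) (n : ℕ) : List (CheckSym X Δ) :=
  κ.map .pos ++ .mark :: (d.map .sym ++ (List.replicate n .pad ++ [.halt]))

/-- The check stacks with a word from `E`. -/
def checkLanguage (X : Type) {Δ : Type} (E : Language Δ) : Language (CheckSym X Δ) :=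
  {l | ∃ κ d n, d ∈ E ∧ l = checkWord κ d n}

/-- States of the automaton that recognises check stacks. -/
inductive CheckState (σ : Type)
  | start
  | inner (s : σ)
  | pads
  | done
  | dead

instance CheckState.finite {σ : Type} [Finite σ] : Finite (CheckState σ) :=
  Finite.of_injective (β := σ ⊕ Fin 4)
    (fun
      | .inner s => .inl s
      | .start => .inr 0
      | .pads => .inr 1
      | .done => .inr 2
      | .dead => .inr 3)
    (by rintro (_ | _ | _ | _) (_ | _ | _ | _) <;> simp)

open Classical in
/-- The transitions of the automaton that recognises check stacks. -/
noncomputable def checkStep {X Δ σ : Type} (N : DFA Δ σ) :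
    CheckState σ → CheckSym X Δ → CheckState σ
  | .start, .pos _ => .start
  | .start, .mark => .inner N.start
  | .inner s, .sym d => .inner (N.step s d)
  | .inner s, .pad => if s ∈ N.accept then .pads else .dead
  | .inner s, .halt => if s ∈ N.accept then .done else .dead
  | .pads, .pad => .pads
  | .pads, .halt => .done
  | _, _ => .dead

/-- The automaton that recognises check stacks. -/
noncomputable def checkDFA (X : Type) {Δ σ : Type} (N : DFA Δ σ) :
    DFA (CheckSym X Δ) (CheckState σ) where
  step := checkStep N
  start := .start
  accept := {.done}

section

variable {X Δ σ : Type} {N : DFA Δ σ}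

theorem checkDFA_step (s : CheckState σ) (a : CheckSym X Δ) :
    (checkDFA X N).step s a = checkStep N s a := rfl

theorem checkDFA_dead (l : List (CheckSym X Δ)) :
    ¬ (checkDFA X N).evalFrom .dead l = .done := by
  induction l with
  | nil => simp
  | cons a l ih => cases a <;> exact ih

theorem checkDFA_done (l : List (CheckSym X Δ)) :
    (checkDFA X N).evalFrom .done l = .done ↔ l = [] := by
  cases l with
  | nil => simp
  | cons a l => cases a <;> simp [checkDFA_step, checkStep, checkDFA_dead]

theorem checkDFA_pads (l : List (CheckSym X Δ)) :
    (checkDFA X N).evalFrom .pads l = .done ↔ ∃ n, l = List.replicate n .pad ++ [.halt] := by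
  induction l with
  | nil => simp
  | cons a l ih =>
    have h0 : (∃ n, a :: l = List.replicate n .pad ++ [.halt]) ↔
        (a = .halt ∧ l = []) ∨ (a = .pad ∧ ∃ n, l = List.replicate n .pad ++ [.halt]) := by
      constructor
      · rintro ⟨_ | n, h⟩
        · simpa using Or.inl h
        · simp only [List.replicate_succ, List.cons_append, List.cons.injEq] at h
          exact .inr ⟨h.1, n, h.2⟩
      · rintro (⟨rfl, rfl⟩ | ⟨rfl, n, rfl⟩)
        · exact ⟨0, rfl⟩
        · exact ⟨n + 1, by simp [List.replicate_succ]⟩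
    rw [h0]
    cases a <;> simp [checkDFA_step, checkStep, checkDFA_dead, checkDFA_done, ih]

theorem checkDFA_inner (s : σ) (l : List (CheckSym X Δ)) :
    (checkDFA X N).evalFrom (.inner s) l = .done ↔ ∃ d n, N.evalFrom s d ∈ N.accept ∧
      l = d.map .sym ++ (List.replicate n .pad ++ [.halt]) := by
  induction l generalizing s with
  | nil => simp
  | cons a l ih =>
    have h0 : (∃ d n, N.evalFrom s d ∈ N.accept ∧
        a :: l = d.map .sym ++ (List.replicate n .pad ++ [.halt])) ↔
        (s ∈ N.accept ∧ ∃ n, a :: l = List.replicate n .pad ++ [.halt]) ∨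
        (∃ b, a = .sym b ∧ ∃ d n, N.evalFrom (N.step s b) d ∈ N.accept ∧
          l = d.map .sym ++ (List.replicate n .pad ++ [.halt])) := by
      constructor
      · rintro ⟨_ | ⟨b, d⟩, n, h₁, h₂⟩
        · exact .inl ⟨h₁, n, h₂⟩
        · simp only [List.map_cons, List.cons_append, List.cons.injEq] at h₂
          exact .inr ⟨b, h₂.1, d, n, h₁, h₂.2⟩
      · rintro (⟨h, n, h'⟩ | ⟨b, rfl, d, n, h, rfl⟩)
        · exact ⟨[], n, h, h'⟩
        · exact ⟨b :: d, n, h, rfl⟩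
    rw [h0, ← checkDFA_pads (N := N), DFA.evalFrom_cons, DFA.evalFrom_cons]
    cases a with
    | sym b =>
      rw [checkDFA_step, checkDFA_step, checkStep, checkStep, ih]
      · simp [checkDFA_dead]
      all_goals simp
    | pad => by_cases hs : s ∈ N.accept <;> simp [checkDFA_step, checkStep, checkDFA_dead, hs]
    | halt => by_cases hs : s ∈ N.accept <;> simp [checkDFA_step, checkStep, checkDFA_dead, hs]
    | _ => simp [checkDFA_step, checkStep, checkDFA_dead]

theorem checkDFA_start (l : List (CheckSym X Δ)) :
    (checkDFA X N).evalFrom .start l = .done ↔ ∃ κ d n, N.evalFrom N.start d ∈ N.accept ∧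
      l = checkWord κ d n := by
  induction l with
  | nil => simp [checkWord]
  | cons a l ih =>
    have h0 : (∃ κ d n, N.evalFrom N.start d ∈ N.accept ∧ a :: l = checkWord κ d n) ↔
        (a = .mark ∧ ∃ d n, N.evalFrom N.start d ∈ N.accept ∧
          l = d.map .sym ++ (List.replicate n .pad ++ [.halt])) ∨
        (∃ x, a = .pos x ∧ ∃ κ d n, N.evalFrom N.start d ∈ N.accept ∧ l = checkWord κ d n) := by
      constructor
      · rintro ⟨_ | ⟨b, κ⟩, d, n, h₁, h₂⟩
        · simp only [checkWord, List.map_nil, List.nil_append, List.cons.injEq] at h₂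
          exact .inl ⟨h₂.1, d, n, h₁, h₂.2⟩
        · simp only [checkWord, List.map_cons, List.cons_append, List.cons.injEq] at h₂
          exact .inr ⟨b, h₂.1, κ, d, n, h₁, h₂.2⟩
      · rintro (⟨rfl, d, n, h, rfl⟩ | ⟨x, rfl, κ, d, n, h, rfl⟩)
        · exact ⟨[], d, n, h, rfl⟩
        · exact ⟨x :: κ, d, n, h, rfl⟩
    rw [h0, ← ih, ← checkDFA_inner (X := X), DFA.evalFrom_cons]
    cases a <;> simp [checkDFA_step, checkStep, checkDFA_dead]

end

theorem checkLanguage_isRegular (X : Type) {Δ : Type} {E : Language Δ} (hE : E.IsRegular) :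
    (checkLanguage X E).IsRegular := by
  obtain ⟨σ, _, N, rfl⟩ := hE
  refine ⟨CheckState σ, Fintype.ofFinite _, checkDFA X N, ?_⟩
  ext l
  exact checkDFA_start l

end CSPDA

/-! ### Normal forms, positions and the letters read at a position. -/

/-- A description of the elements of a group `K` by pairs of a coset representative and an element
of a free group, which is compatible with the action of the free group by right translations. -/
structure FreeCosets (K : Type v) [Group K] where
  X : Type
  T : Type
  [finite_X : Finite X]
  [finite_T : Finite T]
  [decidableEq_X : DecidableEq X]
  nf : K ≃ T × FreeGroup X
  t₀ : T
  nf_one : nf 1 = (t₀, 1)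
  -- Left multiplication by `g` sees only the coset representative of `p` and multiplies the free
  -- part on the left. With the first letter of the reduced word at the top of a stack, this is an
  -- operation at the top.
  nf_mul : ∀ g p, nf (g * p) = ((nf (g * nf.symm ((nf p).1, 1))).1,
    (nf (g * nf.symm ((nf p).1, 1))).2 * (nf p).2)

/-- The input letters of the machine for the wreath product: each stands for a letter in `A` or for
an element of `K`. -/
structure WreathData (𝒜 : Type u) (A : Type w) (K : Type v) [Group K] extends FreeCosets K where
  I : Type
  [finite_I : Finite I]
  letter : I → A
  act : 𝒜 → I ⊕ K
  N : ℕ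
  bound : ∀ z g, act z = .inr g → ∀ t, (nf (g⁻¹ * nf.symm (t, 1))).2.toWord.length ≤ N

attribute [instance] FreeCosets.finite_X FreeCosets.finite_T FreeCosets.decidableEq_X WreathData.finite_I

namespace WreathData

variable {𝒜 : Type u} {A : Type w} {K : Type v} [Group K] (W : WreathData 𝒜 A K)

/-- The position that is reached from `p`; positions are inverses of elements of `K`. -/
def endPos : K → List 𝒜 → K
  | p, [] => p
  | p, z :: w => match W.act z with
    | .inl _ => endPos p w
    | .inr g => endPos (g⁻¹ * p) w

open Classical in
/-- The letters in `A` that are read in positions that satisfy `P`. -/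
noncomputable def hitWord (P : K → Prop) : K → List 𝒜 → List A
  | _, [] => []
  | p, z :: w => match W.act z with
    | .inl i => if P p then W.letter i :: hitWord P p w else hitWord P p w
    | .inr g => hitWord P (g⁻¹ * p) w

variable {W}

theorem endPos_append (p : K) (u v : List 𝒜) :
    W.endPos p (u ++ v) = W.endPos (W.endPos p u) v := by
  induction u generalizing p with
  | nil => rfl
  | cons z u ih =>
    simp only [List.cons_append, endPos]
    cases W.act z <;> exact ih _

theorem hitWord_append (P : K → Prop) (p : K) (u v : List 𝒜) :
    W.hitWord P p (u ++ v) = W.hitWord P p u ++ W.hitWord P (W.endPos p u) v := by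
  induction u generalizing p with
  | nil => rfl
  | cons z u ih =>
    simp only [List.cons_append, endPos, hitWord]
    cases W.act z with
    | inl i => split_ifs <;> simp [ih]
    | inr g => exact ih _

theorem endPos_concat_inl {p : K} {w : List 𝒜} {z : 𝒜} {i : W.I} (h : W.act z = .inl i) :
    W.endPos p (w ++ [z]) = W.endPos p w := by
  simp [endPos_append, endPos, h]

theorem endPos_concat_inr {p : K} {w : List 𝒜} {z : 𝒜} {g : K} (h : W.act z = .inr g) :
    W.endPos p (w ++ [z]) = g⁻¹ * W.endPos p w := by
  simp [endPos_append, endPos, h]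

theorem hitWord_concat_of_mem {P : K → Prop} {p : K} {w : List 𝒜} {z : 𝒜} {i : W.I}
    (h : W.act z = .inl i) (hp : P (W.endPos p w)) :
    W.hitWord P p (w ++ [z]) = W.hitWord P p w ++ [W.letter i] := by
  simp [hitWord_append, hitWord, h, hp]

theorem hitWord_concat_of_notMem {P : K → Prop} {p : K} {w : List 𝒜} {z : 𝒜} {i : W.I}
    (h : W.act z = .inl i) (hp : ¬ P (W.endPos p w)) :
    W.hitWord P p (w ++ [z]) = W.hitWord P p w := by
  simp [hitWord_append, hitWord, h, hp]

theorem hitWord_concat_inr {P : K → Prop} {p : K} {w : List 𝒜} {z : 𝒜} {g : K}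
    (h : W.act z = .inr g) : W.hitWord P p (w ++ [z]) = W.hitWord P p w := by
  simp [hitWord_append, hitWord, h]

theorem endPos_eq_mul (p : K) (w : List 𝒜) : W.endPos p w = W.endPos 1 w * p := by
  induction w using List.reverseRecOn with
  | nil => simp [endPos]
  | append_singleton w z ih =>
    cases h : W.act z with
    | inl i => rw [endPos_concat_inl h, endPos_concat_inl h, ih]
    | inr g => rw [endPos_concat_inr h, endPos_concat_inr h, ih, mul_assoc]

/-- Changing the starting point multiplies all positions by `p` on the right. So what a word
contributes after an earlier one is a coordinate of that word alone, for a shifted target; property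
(3) rests on this. -/
theorem hitWord_translate (P : K → Prop) (p : K) (w : List 𝒜) :
    W.hitWord P p w = W.hitWord (fun k => P (k * p)) 1 w := by
  induction w using List.reverseRecOn with
  | nil => rfl
  | append_singleton w z ih =>
    cases h : W.act z with
    | inl i =>
      by_cases hp : P (W.endPos p w)
      · rw [hitWord_concat_of_mem h hp, hitWord_concat_of_mem h (by rwa [← endPos_eq_mul]), ih]
      · rw [hitWord_concat_of_notMem h hp,
          hitWord_concat_of_notMem h (by rwa [← endPos_eq_mul]), ih]
    | inr g => rw [hitWord_concat_inr h, hitWord_concat_inr h, ih]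

theorem hitWord_eq_nil {P : K → Prop} (hP : ∀ k, ¬ P k) (p : K) (w : List 𝒜) :
    W.hitWord P p w = [] := by
  induction w using List.reverseRecOn with
  | nil => rfl
  | append_singleton w z ih =>
    cases h : W.act z with
    | inl i => rw [hitWord_concat_of_notMem h (hP _), ih]
    | inr g => rw [hitWord_concat_inr h, ih]

end WreathData

namespace CSPDA

/-! ### The stacks -/

/-- Pushdown symbols of the machine for the wreath product: letters of a path, which know whether
everything below them agrees with the check stack; a mark; symbols of the given machine; letters
of a path that starts at the mark. -/
inductive PushSym (X Γ : Type)
  | path (x : X) (b : Bool)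
  | mark
  | sym (g : Γ)
  | rel (x : X)

instance PushSym.finite {X Γ : Type} [Finite X] [Finite Γ] : Finite (PushSym X Γ) :=
  Finite.of_injective (β := (X × Bool) ⊕ Γ ⊕ X ⊕ Unit)
    (fun
      | .path x b => .inl (x, b)
      | .sym d => .inr (.inl d)
      | .rel x => .inr (.inr (.inl x))
      | .mark => .inr (.inr (.inr ())))
    (by rintro (_ | _ | _ | _) (_ | _ | _ | _) <;> simp)

/-- What the read write head sees, in terms of the two stacks. -/
def stackView {Δ Γ : Type} (l : List Δ) : List Γ → Option (Option Δ × Γ)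
  | [] => none
  | g :: t => some (l[t.length]?, g)

theorem Config.view_eq {A : Type u} {M : CSPDA A} (C : M.Config) :
    C.view = stackView C.check C.pushdown := by
  obtain ⟨q, c, _ | ⟨g, t⟩⟩ := C <;> rfl

theorem keep_stackView {Δ Γ : Type} (l : List Δ) (σ : List Γ) :
    keep (stackView l σ) ++ σ.tail = σ := by cases σ <;> rfl

section Stacks

variable {X Δ Γ : Type}

/-- Two letters that cancel in a free group. -/
def Cancels {X : Type} (x y : X × Bool) : Prop := x.1 = y.1 ∧ x.2 = !y.2

theorem toWord_mk_mul_of_cancels [DecidableEq X] {f : FreeGroup X} {x y : X × Bool} {l : List (X × Bool)}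
    (hf : f.toWord = y :: l) (h : Cancels x y) : (FreeGroup.mk [x] * f).toWord = l := by
  rw [← FreeGroup.mk_toWord (x := f), FreeGroup.mul_mk, FreeGroup.toWord_mk, List.singleton_append,
    FreeGroup.reduce.cons, FreeGroup.reduce_toWord, hf]
  exact if_pos h

theorem toWord_mk_mul_of_not_cancels [DecidableEq X] {f : FreeGroup X} {x : X × Bool}
    (h : ∀ y l, f.toWord = y :: l → ¬ Cancels x y) :
    (FreeGroup.mk [x] * f).toWord = x :: f.toWord := by
  conv_lhs => rw [← FreeGroup.mk_toWord (x := f), FreeGroup.mul_mk, FreeGroup.toWord_mk,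
    List.singleton_append, FreeGroup.reduce.cons, FreeGroup.reduce_toWord]
  cases hf : f.toWord with
  | nil => rfl
  | cons y l => exact if_neg (h y l hf)

open Classical in
/-- Whether the pushdown stack agrees with the check stack. -/
noncomputable def onPath : Option (Option (CheckSym X Δ) × PushSym X Γ) → Bool
  | none => true
  | some (some (.pos x), .path y b) => b && decide (x = y)
  | _ => false

/-- The condition under which it is certain that the check stack is higher than the pushdown
stack. -/
def CanPush (s : Option (Option (CheckSym X Δ) × PushSym X Γ)) : Prop :=
  s = none ∨ ∃ d g, s = some (some d, g) ∧ d ≠ .halt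

/-- The part of the view that concerns the given machine. -/
def innerView : Option (Option (CheckSym X Δ) × PushSym X Γ) → Option (Option (Option Δ × Γ))
  | some (_, .mark) => some none
  | some (some (.sym d), .sym g) => some (some (some d, g))
  | _ => none

/-- The mark is at the top of the pushdown stack. -/
def TopMark (s : Option (Option (CheckSym X Δ) × PushSym X Γ)) : Prop := ∃ o, s = some (o, .mark)

/-- A letter of a path that starts at the mark is at the top of the pushdown stack. -/
def TopRel (s : Option (Option (CheckSym X Δ) × PushSym X Γ)) : Prop :=
  ∃ o x, s = some (o, .rel x)

/-- The mark, if it is at the top. -/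
def keepMark : Option (Option (CheckSym X Δ) × PushSym X Γ) → List (PushSym X Γ)
  | some (_, .mark) => [.mark]
  | _ => []

open Classical in
/-- The encoding of a path, top symbol first. -/
noncomputable def encPath (Γ : Type) (κ : List X) : List X → List (PushSym X Γ)
  | [] => []
  | x :: f => .path x (decide (f.reverse <+: κ)) :: encPath Γ κ f

@[simp]
theorem encPath_length (κ f : List X) : (encPath Γ κ f).length = f.length := by
  induction f with
  | nil => rfl
  | cons x f ih => simp [encPath, ih]

/-- The pushdown stack when the given machine is active. -/
noncomputable def encInner (κ : List X) (a : List Γ) : List (PushSym X Γ) :=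
  a.map .sym ++ .mark :: encPath Γ κ κ.reverse

@[simp]
theorem encInner_length (κ : List X) (a : List Γ) :
    (encInner κ a).length = a.length + κ.length + 1 := by
  simp [encInner]
  omega

variable {κ : List X} {d : List Δ} {n : ℕ}

@[simp]
theorem checkWord_length : (checkWord κ d n).length = κ.length + d.length + n + 2 := by
  simp [checkWord]
  omega

theorem checkWord_getElem?_path {j : ℕ} (h : j < κ.length) :
    (checkWord κ d n)[j]? = some (.pos κ[j]) := by
  rw [checkWord, List.getElem?_append_left (by simpa)]
  simp [h]

theorem checkWord_getElem?_mark : (checkWord κ d n)[κ.length]? = some .mark := by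
  rw [checkWord, List.getElem?_append_right (by simp)]
  simp

theorem checkWord_getElem?_sym {j : ℕ} (h : j < d.length) :
    (checkWord κ d n)[j + κ.length + 1]? = some (.sym d[j]) := by
  rw [checkWord, List.getElem?_append_right (by simp; omega)]
  have : j + κ.length + 1 - (κ.map (CheckSym.pos (Δ := Δ))).length = j + 1 := by simp; omega
  rw [this, List.getElem?_cons_succ, List.getElem?_append_left (by simpa)]
  simp [h]

theorem checkWord_getElem?_eq_stop {j : ℕ} :
    (checkWord κ d n)[j]? = some .halt ↔ j = κ.length + d.length + n + 1 := by
  have : checkWord κ d n =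
      (κ.map .pos ++ .mark :: (d.map .sym ++ List.replicate n .pad)) ++ [.halt] := by
    simp [checkWord]
  rw [this]
  set l : List (CheckSym X Δ) := κ.map .pos ++ .mark :: (d.map .sym ++ List.replicate n .pad)
  have hl : l.length = κ.length + d.length + n + 1 := by simp [l]; omega
  have hs : CheckSym.halt ∉ l := by simp [l]
  rw [← hl]
  rcases lt_trichotomy j l.length with h | rfl | h
  · rw [List.getElem?_append_left h]
    exact ⟨fun h' => absurd (List.mem_of_getElem? h') hs, fun h' => absurd h' h.ne⟩
  · simp
  · rw [List.getElem?_append_right h.le, List.getElem?_eq_none (by simp; omega)]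
    simpa using h.ne'

/-- The symbol `halt` occurs only at the top of the check stack, so any other check symbol beside
the top of the pushdown stack certifies room for one more symbol. An empty pushdown stack always has
room, since the check stack is nonempty. -/
theorem canPush_iff {σ : List (PushSym X Γ)} :
    CanPush (stackView (checkWord κ d n) σ) ↔ σ.length < (checkWord κ d n).length := by
  cases σ with
  | nil => simp [CanPush, stackView]
  | cons g t =>
    rw [List.length_cons, checkWord_length]
    constructor
    · rintro (h | ⟨x, g', h, hx⟩)
      · cases h
      · simp only [stackView, Option.some.injEq, Prod.mk.injEq] at h
        have h₁ : t.length < (checkWord κ d n).length := (List.getElem?_eq_some_iff.1 h.1).1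
        rw [checkWord_length] at h₁
        by_contra h₂
        have h₃ := checkWord_getElem?_eq_stop (κ := κ) (d := d) (n := n).2
          (show t.length = _ by omega)
        rw [h.1] at h₃
        exact hx (by simpa using h₃)
    · intro h
      have h₁ : t.length < (checkWord κ d n).length := by rw [checkWord_length]; omega
      refine .inr ⟨(checkWord κ d n)[t.length], g, ?_, fun h₂ => ?_⟩
      · rw [stackView, List.getElem?_eq_getElem h₁]
      · have := checkWord_getElem?_eq_stop.1 ((List.getElem?_eq_getElem h₁).trans (congrArg _ h₂))
        omega

theorem concat_prefix_iff {f : List X} {x : X} :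
    f ++ [x] <+: κ ↔ f <+: κ ∧ κ[f.length]? = some x := by
  constructor
  · rintro ⟨l, rfl⟩
    exact ⟨⟨x :: l, by simp⟩, by simp⟩
  · rintro ⟨⟨l, rfl⟩, h⟩
    cases l with
    | nil => simp at h
    | cons y l =>
      simp only [List.getElem?_append_right le_rfl, Nat.sub_self, List.getElem?_cons_zero,
        Option.some.injEq] at h
      exact ⟨l, by simp [h]⟩

/-- The flag in the top letter vouches for the letters below it, and the view compares the top
letter itself. Above height `κ.length` there are no `pos` symbols, so a path longer than `κ` never
agrees. -/
theorem onPath_encPath {f : List X} :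
    onPath (stackView (checkWord κ d n) (encPath Γ κ f)) = true ↔ f.reverse <+: κ := by
  cases f with
  | nil => simp [encPath, stackView, onPath]
  | cons x f =>
    rw [List.reverse_cons, concat_prefix_iff]
    simp only [encPath, stackView, encPath_length, List.length_reverse]
    by_cases hf : f.length < κ.length
    · rw [checkWord_getElem?_path hf]
      simp [onPath, hf]
    · have h₁ : κ[f.length]? = none := List.getElem?_eq_none (by omega)
      have h₂ : ∀ x, (checkWord κ d n)[f.length]? ≠ some (.pos x) := by
        intro y h
        rcases (not_lt.1 hf).eq_or_lt with h' | h'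
        · rw [← h', checkWord_getElem?_mark] at h
          cases h
        · obtain ⟨j, hj⟩ : ∃ j, f.length = j + κ.length + 1 := ⟨f.length - κ.length - 1, by omega⟩
          rw [checkWord, List.getElem?_append_right (by simp; omega)] at h
          have h₃ := List.mem_of_getElem? h
          simp at h₃
      simp only [h₁, reduceCtorEq, and_false, iff_false, Bool.not_eq_true]
      cases h : (checkWord κ d n)[f.length]? with
      | none => rfl
      | some y =>
        cases y with
        | pos y => exact absurd h (h₂ y)
        | _ => rfl

open Classical in
-- The flag to be pushed concerns the whole stack, yet it can be computed from the view.
theorem encPath_cons (x : X) (f : List X) : encPath Γ κ (x :: f) =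
    .path x (onPath (stackView (checkWord κ d n) (encPath Γ κ f))) :: encPath Γ κ f := by
  rw [encPath]
  congr 2
  exact Bool.eq_iff_iff.2 (decide_eq_true_iff.trans onPath_encPath.symm)

/-- The pushdown stack of the given machine and its check word both begin at height `κ.length + 1`,
so they face each other as in the given machine. The mark plays the role of the bottom. -/
theorem innerView_encInner {a : List Γ} (ha : a.length ≤ d.length) :
    innerView (stackView (checkWord κ d n) (encInner κ a)) = some (stackView d a) := by
  cases a with
  | nil => rfl
  | cons g a =>
    have h : a.length < d.length := ha
    have h₁ : (a.map PushSym.sym ++ PushSym.mark (X := X) :: encPath Γ κ κ.reverse).length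
        = a.length + κ.length + 1 := encInner_length κ a
    simp only [encInner, List.map_cons, List.cons_append, stackView]
    rw [h₁, checkWord_getElem?_sym h, List.getElem?_eq_getElem h]
    rfl

theorem topMark_encInner {a : List Γ} :
    TopMark (stackView (checkWord κ d n) (encInner κ a)) ↔ a = [] := by
  cases a with
  | nil => exact ⟨fun _ => rfl, fun _ => ⟨_, rfl⟩⟩
  | cons g a => simp [TopMark, encInner, stackView]

/-- At its empty stack the given machine replaces nothing, whereas here the mark is the top symbol
and has to be written back. -/
theorem keepMark_encInner (w a : List Γ) :
    w.map .sym ++ keepMark (stackView (checkWord κ d n) (encInner κ a)) ++ (encInner κ a).tail =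
      encInner κ (w ++ a.tail) := by
  cases a with
  | nil => simp [encInner, stackView, keepMark]
  | cons g a => simp [encInner, stackView, keepMark]

theorem topRel_iff {f : List X} {a : List Γ} :
    TopRel (stackView (checkWord κ d n) (f.map .rel ++ encInner κ a)) ↔ f ≠ [] := by
  cases f with
  | nil => cases a <;> simp [TopRel, encInner, stackView]
  | cons x f => simp [TopRel, stackView]

end Stacks

end CSPDA

/-! ### The machine for the wreath product. -/

namespace CSPDA

variable {𝒜 : Type u} {A : Type w} {K : Type v} [Group K]

/-- A word in the free group that has still to be multiplied to the position. -/
abbrev Pending (W : WreathData 𝒜 A K) : Type := {c : List (W.X × Bool) // c.length ≤ W.N}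

/-- Nothing is pending. -/
def Pending.nil (W : WreathData 𝒜 A K) : Pending W := ⟨[], Nat.zero_le _⟩

instance (W : WreathData 𝒜 A K) : Finite (Pending W) :=
  (List.finite_length_le (W.X × Bool) W.N).to_subtype

/-- Control states of the machine for the wreath product. In the `outer` states, the given machine
is in its entry configuration and the pushdown stack contains the path to the current position. In
the `inner` states, the pushdown stack contains that of the given machine, followed by a path that
starts at the position where the given machine is active. -/
inductive WreathCore (W : WreathData 𝒜 A K) (Q : Type)
  | outer (t : W.T) (e : Bool)
  | outerPend (t : W.T) (c : Pending W)
  | probe (i : W.I)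
  | run (q : Q)
  | inner (q : Q) (t : W.T)
  | innerPend (q : Q) (t : W.T) (c : Pending W)

instance WreathCore.finite (W : WreathData 𝒜 A K) {Q : Type} [Finite Q] :
    Finite (WreathCore W Q) :=
  Finite.of_injective (β := (W.T × Bool) ⊕ (W.T × Pending W) ⊕ W.I ⊕ Q ⊕ (Q × W.T) ⊕
      (Q × W.T × Pending W))
    (fun
      | .outer t e => .inl (t, e)
      | .outerPend t c => .inr (.inl (t, c))
      | .probe i => .inr (.inr (.inl i))
      | .run q => .inr (.inr (.inr (.inl q)))
      | .inner q t => .inr (.inr (.inr (.inr (.inl (q, t)))))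
      | .innerPend q t c => .inr (.inr (.inr (.inr (.inr (q, t, c))))))
    (by rintro (_ | _ | _ | _) (_ | _ | _ | _) <;> simp)

/-- The moves of the machine for the wreath product; `st` consists of the entry state of the given
machine (if that is to be used) and the coset representative of the position where it is active. -/
inductive WreathMove (W : WreathData 𝒜 A K) (M : CSPDA A) (R : Set M.Q)
    (st : Option M.Q × W.T) : WreathCore W M.Q → Option 𝒜 →
    Option (Option (CheckSym (W.X × Bool) M.Δ) × PushSym (W.X × Bool) M.Γ) →
    WreathCore W M.Q → List (PushSym (W.X × Bool) M.Γ) → Prop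
  | outer_move {t e z s g} {c : Pending W} : W.act z = .inr g →
      c.1 = (W.nf (g⁻¹ * W.nf.symm (t, 1))).2.toWord.reverse →
      WreathMove W M R st (.outer t e) (some z) s
        (.outerPend (W.nf (g⁻¹ * W.nf.symm (t, 1))).1 c) (keep s)
  | outer_skip {t e z s i} : W.act z = .inl i →
      ¬ (st.1.isSome = true ∧ t = st.2 ∧ onPath s = true) →
      WreathMove W M R st (.outer t e) (some z) s (.outer t e) (keep s)
  -- Agreement with `κ` does not show that the path is all of `κ`. Pushing a mark exposes the next
  -- check symbol, which is `mark` exactly when `κ` is exhausted.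
  | outer_probe {t e z s i} : W.act z = .inl i →
      (st.1.isSome = true ∧ t = st.2 ∧ onPath s = true) →
      WreathMove W M R st (.outer t e) (some z) s (.probe i) (.mark :: keep s)
  -- Acceptance depends on the state alone, so the emptiness of the path is stored there.
  | outer_done {t s} {c : Pending W} : c.1 = [] →
      WreathMove W M R st (.outerPend t c) none s (.outer t s.isNone) (keep s)
  | outer_pop {t s x o y b} {c c' : Pending W} : c.1 = x :: c'.1 →
      s = some (o, .path y b) → Cancels x y →
      WreathMove W M R st (.outerPend t c) none s (.outerPend t c') []
  | outer_push {t s x} {c c' : Pending W} : c.1 = x :: c'.1 → CanPush s →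
      (∀ o y b, s = some (o, .path y b) → ¬ Cancels x y) →
      WreathMove W M R st (.outerPend t c) none s (.outerPend t c')
        (.path x (onPath s) :: keep s)
  | probe_miss {i s} : (∀ g, s ≠ some (some .mark, g)) →
      WreathMove W M R st (.probe i) none s (.outerPend st.2 (.nil W)) []
  | probe_hit {i s g q₀ q' w} : s = some (some .mark, g) → st.1 = some q₀ →
      (q', w) ∈ M.δ q₀ (some (W.letter i)) none →
      WreathMove W M R st (.probe i) none s (.run q') (w.map .sym ++ [.mark])
  | run_silent {q s m q' w} : innerView s = some m → (q', w) ∈ M.δ q none m →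
      WreathMove W M R st (.run q) none s (.run q') (w.map .sym ++ keepMark s)
  -- The given machine is back in its entry configuration, and the absolute path under the mark is
  -- uncovered. Without this return the mode would depend on the history, which property (3)
  -- forbids.
  | run_init {q s} : q ∈ R → (st.1 = some q ∧ TopMark s) →
      WreathMove W M R st (.run q) none s (.outerPend st.2 (.nil W)) []
  | run_rest {q s} : q ∈ R → ¬ (st.1 = some q ∧ TopMark s) →
      WreathMove W M R st (.run q) none s (.inner q W.t₀) (keep s)
  | inner_move {q t z s g} {c : Pending W} : W.act z = .inr g →
      c.1 = (W.nf (g⁻¹ * W.nf.symm (t, 1))).2.toWord.reverse →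
      WreathMove W M R st (.inner q t) (some z) s
        (.innerPend q (W.nf (g⁻¹ * W.nf.symm (t, 1))).1 c) (keep s)
  | inner_skip {q t z s i} : W.act z = .inl i → ¬ (t = W.t₀ ∧ ¬ TopRel s) →
      WreathMove W M R st (.inner q t) (some z) s (.inner q t) (keep s)
  | inner_read {q t z s i m q' w} : W.act z = .inl i → (t = W.t₀ ∧ ¬ TopRel s) →
      innerView s = some m → (q', w) ∈ M.δ q (some (W.letter i)) m →
      WreathMove W M R st (.inner q t) (some z) s (.run q') (w.map .sym ++ keepMark s)
  | inner_done {q t s} {c : Pending W} : c.1 = [] →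
      WreathMove W M R st (.innerPend q t c) none s (.inner q t) (keep s)
  | inner_pop {q t s x o y} {c c' : Pending W} : c.1 = x :: c'.1 →
      s = some (o, .rel y) → Cancels x y →
      WreathMove W M R st (.innerPend q t c) none s (.innerPend q t c') []
  | inner_push {q t s x} {c c' : Pending W} : c.1 = x :: c'.1 → CanPush s →
      (∀ o y, s = some (o, .rel y) → ¬ Cancels x y) →
      WreathMove W M R st (.innerPend q t c) none s (.innerPend q t c') (.rel x :: keep s)

section

variable {W : WreathData 𝒜 A K} {M : CSPDA A} {R : Set M.Q} {st : Option M.Q × W.T}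

theorem WreathMove.unique (h : M.IsDet R) {p a s p₁ w₁ p₂ w₂}
    (h₁ : WreathMove W M R st p a s p₁ w₁) (h₂ : WreathMove W M R st p a s p₂ w₂) :
    (p₁, w₁) = (p₂, w₂) := by
  have hR : ∀ {q s r}, q ∈ R → r ∈ M.δ q none s → False :=
    fun hq hr => (h.reading_moves _ hq _).le hr
  have hc : ∀ {c c₁ c₂ : Pending W} {x y}, c.1 = x :: c₁.1 → c.1 = y :: c₂.1 →
      x = y ∧ c₁ = c₂ := by
    intro c c₁ c₂ x y h₁ h₂
    rw [h₁, List.cons.injEq] at h₂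
    exact ⟨h₂.1, Subtype.ext h₂.2⟩
  cases h₁ with
  | outer_move h₁ h₁' =>
    cases h₂ with
    | outer_move h₂ h₂' =>
      cases h₁.symm.trans h₂
      rw [Subtype.ext (h₁'.trans h₂'.symm)]
    | outer_skip h₂ => cases h₁.symm.trans h₂
    | outer_probe h₂ => cases h₁.symm.trans h₂
  | outer_skip h₁ h₁' =>
    cases h₂ with
    | outer_move h₂ => cases h₁.symm.trans h₂
    | outer_skip h₂ => rfl
    | outer_probe h₂ h₂' => exact absurd h₂' h₁'
  | outer_probe h₁ h₁' =>
    cases h₂ with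
    | outer_move h₂ => cases h₁.symm.trans h₂
    | outer_skip h₂ h₂' => exact absurd h₁' h₂'
    | outer_probe h₂ => cases h₁.symm.trans h₂; rfl
  | outer_done h₁ =>
    cases h₂ with
    | outer_done h₂ => rfl
    | outer_pop h₂ => cases h₁.symm.trans h₂
    | outer_push h₂ => cases h₁.symm.trans h₂
  | outer_pop h₁ h₁' h₁'' =>
    cases h₂ with
    | outer_done h₂ => cases h₁.symm.trans h₂
    | outer_pop h₂ => rw [(hc h₁ h₂).2]
    | outer_push h₂ _ h₂' => exact absurd ((hc h₁ h₂).1 ▸ h₁'') (h₂' _ _ _ h₁')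
  | outer_push h₁ _ h₁' =>
    cases h₂ with
    | outer_done h₂ => cases h₁.symm.trans h₂
    | outer_pop h₂ h₂' h₂'' => exact absurd ((hc h₁ h₂).1 ▸ h₂'') (h₁' _ _ _ h₂')
    | outer_push h₂ => rw [(hc h₁ h₂).1, (hc h₁ h₂).2]
  | probe_miss h₁ =>
    cases h₂ with
    | probe_miss => rfl
    | probe_hit h₂ => exact absurd h₂ (h₁ _)
  | probe_hit h₁ h₁' h₁'' =>
    cases h₂ with
    | probe_miss h₂ => exact absurd h₁ (h₂ _)
    | probe_hit h₂ h₂' h₂'' =>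
      cases h₁'.symm.trans h₂'
      cases h.deterministic _ _ _ h₁'' h₂''
      rfl
  | run_silent h₁ h₁' =>
    cases h₂ with
    | run_silent h₂ h₂' =>
      cases h₁.symm.trans h₂
      cases h.deterministic _ _ _ h₁' h₂'
      rfl
    | run_init h₂ => exact (hR h₂ h₁').elim
    | run_rest h₂ => exact (hR h₂ h₁').elim
  | run_init h₁ h₁' =>
    cases h₂ with
    | run_silent h₂ h₂' => exact (hR h₁ h₂').elim
    | run_init h₂ => rfl
    | run_rest h₂ h₂' => exact absurd h₁' h₂'
  | run_rest h₁ h₁' =>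
    cases h₂ with
    | run_silent h₂ h₂' => exact (hR h₁ h₂').elim
    | run_init h₂ h₂' => exact absurd h₂' h₁'
    | run_rest h₂ h₂' => rfl
  | inner_move h₁ h₁' =>
    cases h₂ with
    | inner_move h₂ h₂' =>
      cases h₁.symm.trans h₂
      rw [Subtype.ext (h₁'.trans h₂'.symm)]
    | inner_skip h₂ => cases h₁.symm.trans h₂
    | inner_read h₂ => cases h₁.symm.trans h₂
  | inner_skip h₁ h₁' =>
    cases h₂ with
    | inner_move h₂ => cases h₁.symm.trans h₂
    | inner_skip h₂ => rfl
    | inner_read h₂ h₂' => exact absurd h₂' h₁'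
  | inner_read h₁ h₁' h₁'' h₁''' =>
    cases h₂ with
    | inner_move h₂ => cases h₁.symm.trans h₂
    | inner_skip h₂ h₂' => exact absurd h₁' h₂'
    | inner_read h₂ _ h₂'' h₂''' =>
      cases h₁.symm.trans h₂
      cases h₁''.symm.trans h₂''
      cases h.deterministic _ _ _ h₁''' h₂'''
      rfl
  | inner_done h₁ =>
    cases h₂ with
    | inner_done h₂ => rfl
    | inner_pop h₂ => cases h₁.symm.trans h₂
    | inner_push h₂ => cases h₁.symm.trans h₂
  | inner_pop h₁ h₁' h₁'' =>
    cases h₂ with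
    | inner_done h₂ => cases h₁.symm.trans h₂
    | inner_pop h₂ => rw [(hc h₁ h₂).2]
    | inner_push h₂ _ h₂' => exact absurd ((hc h₁ h₂).1 ▸ h₁'') (h₂' _ _ h₁')
  | inner_push h₁ _ h₁' =>
    cases h₂ with
    | inner_done h₂ => cases h₁.symm.trans h₂
    | inner_pop h₂ h₂' h₂'' => exact absurd ((hc h₁ h₂).1 ▸ h₂'') (h₁' _ _ h₂')
    | inner_push h₂ => rw [(hc h₁ h₂).1, (hc h₁ h₂).2]

end

/-- The machine for the wreath product. -/
noncomputable def wreath (W : WreathData 𝒜 A K) {M : CSPDA A} {R : Set M.Q} (hM : M.IsDet R) :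
    CSPDA 𝒜 where
  Q := (Option M.Q × W.T) × WreathCore W M.Q
  Δ := CheckSym (W.X × Bool) M.Δ
  Γ := PushSym (W.X × Bool) M.Γ
  finite_Q := haveI := M.finite_Q; inferInstance
  finite_Δ := haveI := M.finite_Δ; inferInstance
  finite_Γ := haveI := M.finite_Γ; inferInstance
  entry p := {l | p.2 = .outer W.t₀ true ∧
    -- With no entry state guessed, the given machine is never used and its part of the check stack
    -- is arbitrary. This choice serves to detect a nontrivial component in `K`.
    l ∈ checkLanguage (W.X × Bool) (p.1.1.elim 0ᶜ M.entry)}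
  entry_regular p := by
    by_cases hp : p.2 = .outer W.t₀ true
    · simp only [hp, true_and]
      refine checkLanguage_isRegular _ ?_
      cases p.1.1 with
      | none => exact Language.isRegular_empty.compl
      | some q => exact M.entry_regular q
    · simp only [hp, false_and]
      exact Language.isRegular_empty
  δ p a s := {r | r.1.1 = p.1 ∧ WreathMove W M R p.1 p.2 a s r.1.2 r.2}
  δ_finite p a s := Set.Subsingleton.finite fun r₁ h₁ r₂ h₂ => by
    have := WreathMove.unique hM h₁.2 h₂.2
    rw [Prod.mk.injEq] at this
    exact Prod.ext (Prod.ext (h₁.1.trans h₂.1.symm) this.1) this.2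
  accept := {p | (∃ t e, p.2 = .outer t e ∧ (t ≠ W.t₀ ∨ e = false)) ∨
    ∃ q t, p.2 = .inner q t ∧ q ∈ M.accept}

variable {W : WreathData 𝒜 A K} {M : CSPDA A} {R : Set M.Q} {hM : M.IsDet R}
  {st : Option M.Q × W.T}

variable (W) in
/-- The reading states of the machine for the wreath product. -/
def wreathReading (hM : M.IsDet R) : Set (wreath W hM).Q :=
  {p | (∃ t e, p.2 = .outer t e) ∨ ∃ q t, p.2 = .inner q t}

theorem wreath_isDet : (wreath W hM).IsDet (wreathReading W hM) where
  reading_moves := by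
    rintro ⟨st, p⟩ hp s
    refine Set.eq_empty_of_forall_notMem fun ⟨p', w⟩ hp' => ?_
    obtain ⟨-, hp'⟩ := hp'
    rcases hp with ⟨t, e, rfl⟩ | ⟨q, t, rfl⟩ <;> cases hp'
  silent_moves := by
    rintro ⟨st, p⟩ hp a s
    refine Set.eq_empty_of_forall_notMem fun ⟨p', w⟩ hp' => hp ?_
    have hp' : WreathMove W M R st p _ s p'.2 w := hp'.2
    generalize p'.2 = p'' at hp'
    cases hp' with
    | outer_move | outer_skip | outer_probe => exact .inl ⟨_, _, rfl⟩
    | inner_move | inner_skip | inner_read => exact .inr ⟨_, _, rfl⟩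
  deterministic p a s r₁ h₁ r₂ h₂ := by
    have := WreathMove.unique hM h₁.2 h₂.2
    rw [Prod.mk.injEq] at this
    exact Prod.ext (Prod.ext (h₁.1.trans h₂.1.symm) this.1) this.2

/-- A configuration of the machine for the wreath product. -/
def wreathConfig (hM : M.IsDet R) (st : Option M.Q × W.T) (l : List (CheckSym (W.X × Bool) M.Δ))
    (p : WreathCore W M.Q) (σ : List (PushSym (W.X × Bool) M.Γ)) : (wreath W hM).Config :=
  ⟨(st, p), l, σ⟩

theorem wreath_step {l p σ a} {D : (wreath W hM).Config}
    (h : (wreath W hM).Step (wreathConfig hM st l p σ) a D) :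
    ∃ p' w, D = wreathConfig hM st l p' (w ++ σ.tail) ∧
      WreathMove W M R st p a (stackView l σ) p' w := by
  obtain ⟨w, ⟨h₁, h₁'⟩, h₂, h₃⟩ := h
  rw [Config.view_eq] at h₁'
  exact ⟨D.state.2, w, CSPDA.Config.ext (Prod.ext h₁ rfl) h₂ h₃, h₁'⟩

theorem wreath_step_of_move {l p σ a p' w} (h : WreathMove W M R st p a (stackView l σ) p' w) :
    (wreath W hM).Step (wreathConfig hM st l p σ) a (wreathConfig hM st l p' (w ++ σ.tail)) := by
  refine ⟨w, ⟨rfl, ?_⟩, rfl, rfl⟩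
  rw [Config.view_eq]
  exact h

end CSPDA

/-! ### The invariant, termination and progress. -/

namespace CSPDA

variable {𝒜 : Type u} {A : Type w} {K : Type v} [Group K]

/-- The position with coset representative `t` and path `κ`, if there is one. -/
def Target (W : WreathData 𝒜 A K) (t : W.T) (κ : List (W.X × Bool)) (p : K) : Prop :=
  (W.nf p).1 = t ∧ (W.nf p).2.toWord = κ.reverse

variable {W : WreathData 𝒜 A K} {M : CSPDA A} {R : Set M.Q} {L : Language A} {hM : M.IsDet R}
  {st : Option M.Q × W.T} {κ : List (W.X × Bool)} {d : List M.Δ} {n : ℕ}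

theorem Target.unique {t : W.T} {p p' : K} (h : Target W t κ p) (h' : Target W t κ p') :
    p = p' :=
  W.nf.injective (Prod.ext (h.1.trans h'.1.symm)
    (FreeGroup.toWord_injective (h.2.trans h'.2.symm)))

variable (W) in
/-- The position after reading a word. -/
def pos (w : List 𝒜) : K := W.endPos 1 w

/-- The letters that are passed on to the given machine. -/
noncomputable def hits (W : WreathData 𝒜 A K) (t : W.T) (κ : List (W.X × Bool))
    (w : List 𝒜) : List A := W.hitWord (Target W t κ) 1 w

/-- The pending word is stored reversed because a left factor is multiplied on letter by letter,
starting with its last letter. -/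
theorem nf_shift {g p : K} {c : Pending W}
    (hc : c.1 = (W.nf (g⁻¹ * W.nf.symm ((W.nf p).1, 1))).2.toWord.reverse) :
    W.nf (g⁻¹ * p) = ((W.nf (g⁻¹ * W.nf.symm ((W.nf p).1, 1))).1,
      FreeGroup.mk c.1.reverse * (W.nf p).2) := by
  rw [W.nf_mul, hc, List.reverse_reverse, FreeGroup.mk_toWord]

/-- The configurations that the machine for the wreath product reaches on input `w`. -/
inductive WreathInv (hM : M.IsDet R) (st : Option M.Q × W.T) (κ : List (W.X × Bool))
    (d : List M.Δ) (n : ℕ) : List 𝒜 → (wreath W hM).Config → Prop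
  | outer {w} :
      (∀ q₀, st.1 = some q₀ → M.Run ⟨q₀, d, []⟩ (hits W st.2 κ w) ⟨q₀, d, []⟩) →
      -- The summand `κ.length` covers the return from inner mode, where the path is `κ` and the
      -- invariant has kept no other bound on it.
      (W.nf (pos W w)).2.toWord.length ≤ κ.length + W.N * w.length →
      (W.nf (pos W w)).2.toWord.length ≤ (checkWord κ d n).length →
      WreathInv hM st κ d n w (wreathConfig hM st (checkWord κ d n)
        (.outer (W.nf (pos W w)).1 (decide ((W.nf (pos W w)).2 = 1)))
        (encPath M.Γ κ (W.nf (pos W w)).2.toWord))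
  | outerPend {w t f} {c : Pending W} :
      (∀ q₀, st.1 = some q₀ → M.Run ⟨q₀, d, []⟩ (hits W st.2 κ w) ⟨q₀, d, []⟩) →
      W.nf (pos W w) = (t, FreeGroup.mk c.1.reverse * f) →
      f.toWord.length + c.1.length ≤ κ.length + W.N * w.length →
      f.toWord.length ≤ (checkWord κ d n).length →
      WreathInv hM st κ d n w (wreathConfig hM st (checkWord κ d n) (.outerPend t c)
        (encPath M.Γ κ f.toWord))
  | probe {w i q₀ f h} : st.1 = some q₀ → W.nf (pos W w) = (st.2, f) →
      f.toWord.reverse <+: κ → M.Run ⟨q₀, d, []⟩ h ⟨q₀, d, []⟩ →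
      (f.toWord = κ.reverse → hits W st.2 κ w = h ++ [W.letter i]) →
      (f.toWord ≠ κ.reverse → hits W st.2 κ w = h) →
      WreathInv hM st κ d n w (wreathConfig hM st (checkWord κ d n) (.probe i)
        (.mark :: encPath M.Γ κ f.toWord))
  | run {w q₀ q a} : st.1 = some q₀ → Target W st.2 κ (pos W w) →
      M.Run ⟨q₀, d, []⟩ (hits W st.2 κ w) ⟨q, d, a⟩ →
      WreathInv hM st κ d n w (wreathConfig hM st (checkWord κ d n) (.run q) (encInner κ a))
  | inner {w q₀ q a p₀} : st.1 = some q₀ → Target W st.2 κ p₀ →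
      M.After R ⟨q₀, d, []⟩ (hits W st.2 κ w) ⟨q, d, a⟩ → ¬ (q = q₀ ∧ a = []) →
      (W.nf (pos W w * p₀⁻¹)).2.toWord.length ≤ W.N * w.length →
      (W.nf (pos W w * p₀⁻¹)).2.toWord.length + (encInner κ a).length ≤
        (checkWord κ d n).length →
      WreathInv hM st κ d n w (wreathConfig hM st (checkWord κ d n)
        (.inner q (W.nf (pos W w * p₀⁻¹)).1)
        ((W.nf (pos W w * p₀⁻¹)).2.toWord.map .rel ++ encInner κ a))
  | innerPend {w q₀ q a p₀ t f} {c : Pending W} : st.1 = some q₀ → Target W st.2 κ p₀ →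
      M.After R ⟨q₀, d, []⟩ (hits W st.2 κ w) ⟨q, d, a⟩ → ¬ (q = q₀ ∧ a = []) →
      W.nf (pos W w * p₀⁻¹) = (t, FreeGroup.mk c.1.reverse * f) →
      f.toWord.length + c.1.length ≤ W.N * w.length →
      f.toWord.length + (encInner κ a).length ≤ (checkWord κ d n).length →
      WreathInv hM st κ d n w (wreathConfig hM st (checkWord κ d n) (.innerPend q t c)
        (f.toWord.map .rel ++ encInner κ a))

/-- Moving one letter from the pending word to the position. -/
theorem mk_reverse_cons_mul {X : Type} (x : X × Bool) (c : List (X × Bool)) (f : FreeGroup X) :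
    FreeGroup.mk (x :: c).reverse * f = FreeGroup.mk c.reverse * (FreeGroup.mk [x] * f) := by
  rw [List.reverse_cons, ← FreeGroup.mul_mk, mul_assoc]

theorem run_length_le (hP : M.IsPre R L) {q₀ q : M.Q} {a : List M.Γ} {w : List A}
    (hd : d ∈ M.entry q₀) (h : M.Run ⟨q₀, d, []⟩ w ⟨q, d, a⟩) : a.length ≤ d.length :=
  hP.bounded _ _ _ ⟨hd, rfl⟩ h

theorem step_of_mem {q q' : M.Q} {x : Option A} {a w : List M.Γ}
    (h : (q', w) ∈ M.δ q x (stackView d a)) : M.Step ⟨q, d, a⟩ x ⟨q', d, w ++ a.tail⟩ := by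
  refine ⟨w, ?_, rfl, rfl⟩
  rw [Config.view_eq]
  exact h

theorem isNone_stackView_encPath {l : List (CheckSym (W.X × Bool) M.Δ)}
    {f : FreeGroup W.X} : (stackView l (encPath M.Γ κ f.toWord)).isNone = decide (f = 1) := by
  rw [Bool.eq_iff_iff, decide_eq_true_iff, ← FreeGroup.toWord_eq_nil_iff]
  cases f.toWord <;> simp [encPath, stackView]

theorem not_target_of_not_onPath {p : K} {t : W.T}
    (h : ¬ ((W.nf p).1 = t ∧ onPath (stackView (checkWord κ d n)
      (encPath M.Γ κ (W.nf p).2.toWord)) = true)) : ¬ Target W t κ p := by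
  rintro ⟨h₁, h₂⟩
  refine h ⟨h₁, onPath_encPath.2 ?_⟩
  rw [h₂, List.reverse_reverse]

theorem nf_pending {t f} {c c' : Pending W} {x : W.X × Bool}
    (hc : c.1 = x :: c'.1) {p : K} (h : W.nf p = (t, FreeGroup.mk c.1.reverse * f)) :
    W.nf p = (t, FreeGroup.mk c'.1.reverse * (FreeGroup.mk [x] * f)) := by
  rw [h, hc, mk_reverse_cons_mul]

theorem eq_of_nf_mul_inv {p p₀ : K} (h₁ : (W.nf (p * p₀⁻¹)).1 = W.t₀)
    (h₂ : (W.nf (p * p₀⁻¹)).2.toWord = []) : p = p₀ := by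
  rw [FreeGroup.toWord_eq_nil_iff] at h₂
  exact mul_inv_eq_one.1 (W.nf.injective ((Prod.ext h₁ h₂).trans W.nf_one.symm))

/-- The point is that exactly the letters read at the target are passed on. In outer mode a target
position would agree with the check stack, so a skipped letter is no hit; in inner mode the position
is the target iff its relative normal form is trivial. -/
theorem WreathInv.step (hP : M.IsPre R L) (hd : ∀ q₀, st.1 = some q₀ → d ∈ M.entry q₀)
    {w : List 𝒜} {C D : (wreath W hM).Config} {a : Option 𝒜}
    (hinv : WreathInv hM st κ d n w C) (hstep : (wreath W hM).Step C a D) :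
    WreathInv hM st κ d n (w ++ a.toList) D := by
  cases hinv with
  | outer hrun hlen hlen' =>
    obtain ⟨p', w', rfl, hm⟩ := wreath_step hstep
    cases hm with
    | @outer_move _ _ z _ g c hz hc =>
      rw [keep_stackView]
      refine .outerPend ?_ ?_ ?_ hlen'
      · intro q₀ hq₀
        rw [Option.toList_some, hits, WreathData.hitWord_concat_inr hz]
        exact hrun q₀ hq₀
      · rw [Option.toList_some, pos, WreathData.endPos_concat_inr hz]
        exact nf_shift hc
      · have := c.2
        simp only [Option.toList_some, List.length_append, List.length_singleton, mul_add]
        omega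
    | @outer_skip _ _ z _ i hz hs =>
      rw [keep_stackView, Option.toList_some]
      have hpos : pos W (w ++ [z]) = pos W w := WreathData.endPos_concat_inl hz
      rw [← hpos] at hlen hlen' ⊢
      refine .outer ?_ (hlen.trans ?_) hlen'
      · intro q₀ hq₀
        rw [hits, WreathData.hitWord_concat_of_notMem hz]
        · exact hrun q₀ hq₀
        · exact not_target_of_not_onPath (M := M) (d := d) (n := n)
            fun h => hs ⟨by simp [hq₀], h⟩
      · simp only [List.length_append, mul_add]
        omega
    | @outer_probe _ _ z _ i hz hs =>
      rw [List.cons_append, keep_stackView, Option.toList_some]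
      obtain ⟨h₁, h₂, h₃⟩ := hs
      obtain ⟨q₀, hq₀⟩ := Option.isSome_iff_exists.1 h₁
      have hpos : pos W (w ++ [z]) = pos W w := WreathData.endPos_concat_inl hz
      refine .probe hq₀ (by rw [hpos, ← h₂]) (onPath_encPath.1 h₃) (hrun q₀ hq₀) ?_ ?_
      · intro h
        exact WreathData.hitWord_concat_of_mem hz ⟨h₂, h⟩
      · intro h
        exact WreathData.hitWord_concat_of_notMem hz fun h' => h h'.2
  | @outerPend t f c hrun hnf hlen hlen' =>
    obtain ⟨p', w', rfl, hm⟩ := wreath_step hstep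
    cases hm with
    | outer_done hc =>
      rw [keep_stackView, isNone_stackView_encPath, Option.toList_none, List.append_nil]
      rw [hc, List.reverse_nil, ← FreeGroup.one_eq_mk, one_mul] at hnf
      have h₁ : t = (W.nf (pos W w)).1 := by rw [hnf]
      have h₂ : f = (W.nf (pos W w)).2 := by rw [hnf]
      rw [h₁, h₂]
      rw [h₂] at hlen hlen'
      exact .outer hrun (by omega) hlen'
    | @outer_pop _ _ x o y b _ c' hc hs hxy =>
      rw [Option.toList_none, List.append_nil]
      cases hf : f.toWord with
      | nil =>
        rw [hf] at hs
        cases hs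
      | cons y' l =>
        rw [hf] at hs
        simp only [encPath, stackView, Option.some.injEq, Prod.mk.injEq,
          PushSym.path.injEq] at hs
        rw [← hs.2.1] at hxy
        have hl := toWord_mk_mul_of_cancels hf hxy
        simp only [List.nil_append, encPath, List.tail_cons]
        simp only [hf, hc, List.length_cons] at hlen hlen'
        rw [← hl]
        exact .outerPend hrun (nf_pending hc hnf) (by rw [hl]; omega) (by rw [hl]; omega)
    | @outer_push _ _ x _ c' hc hs hxy =>
      rw [Option.toList_none, List.append_nil, List.cons_append, keep_stackView]
      have hl : (FreeGroup.mk [x] * f).toWord = x :: f.toWord := by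
        refine toWord_mk_mul_of_not_cancels fun y l hf => ?_
        rw [hf] at hxy
        exact hxy _ _ _ rfl
      rw [canPush_iff, encPath_length] at hs
      have : PushSym.path x (onPath (stackView (checkWord κ d n) (encPath M.Γ κ f.toWord))) ::
          encPath M.Γ κ f.toWord = encPath M.Γ κ (FreeGroup.mk [x] * f).toWord := by
        rw [hl, encPath_cons]
      rw [this]
      simp only [hc, List.length_cons] at hlen
      exact .outerPend hrun (nf_pending hc hnf) (by rw [hl, List.length_cons]; omega)
        (by rw [hl, List.length_cons]; omega)
  | @probe i q₀ f h hq₀ hnf hf hrun hhit hmiss =>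
    obtain ⟨p', w', rfl, hm⟩ := wreath_step hstep
    have hle := hf.length_le
    rw [List.length_reverse] at hle
    cases hm with
    | probe_miss hs =>
      rw [Option.toList_none, List.append_nil, List.nil_append, List.tail_cons]
      have hne : f.toWord ≠ κ.reverse := by
        intro hf'
        refine hs .mark ?_
        rw [stackView, encPath_length, hf', List.length_reverse, checkWord_getElem?_mark]
      refine .outerPend ?_ ?_ ?_ ?_
      · intro q₁ hq₁
        rw [hmiss hne]
        rw [hq₀, Option.some.injEq] at hq₁
        exact hq₁ ▸ hrun
      · rw [hnf, Pending.nil, List.reverse_nil, ← FreeGroup.one_eq_mk, one_mul]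
      · simp only [Pending.nil, List.length_nil]
        omega
      · rw [checkWord_length]
        omega
    | probe_hit hs hq₀' hw' =>
      rw [hq₀, Option.some.injEq] at hq₀'
      subst hq₀'
      rw [Option.toList_none, List.append_nil, List.tail_cons]
      -- Below height `κ.length` the check stack has only `pos` symbols, so a prefix of `κ` whose
      -- probe meets the mark has full length.
      have hf' : f.toWord = κ.reverse := by
        rcases hle.lt_or_eq with hlt | heq
        · simp only [stackView, encPath_length, Option.some.injEq, Prod.mk.injEq] at hs
          rw [checkWord_getElem?_path hlt] at hs
          simp at hs
        · rw [← hf.eq_of_length (by simpa using heq), List.reverse_reverse]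
      rw [hf', List.append_assoc]
      refine .run hq₀ ?_ ?_
      · rw [Target, hnf]
        exact ⟨rfl, hf'⟩
      · rw [hhit hf']
        have := hrun.step (step_of_mem (d := d) (a := []) hw')
        simpa using this
  | @run q₀ q b hq₀ ht hrun =>
    obtain ⟨p', w', rfl, hm⟩ := wreath_step hstep
    have hb := run_length_le hP (hd q₀ hq₀) hrun
    cases hm with
    | run_silent hs hw' =>
      rw [innerView_encInner hb, Option.some.injEq] at hs
      subst hs
      rw [keepMark_encInner, Option.toList_none, List.append_nil]
      exact .run hq₀ ht (by simpa using hrun.step (step_of_mem hw'))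
    | run_init hR hs =>
      obtain ⟨hs, hs'⟩ := hs
      rw [hq₀, Option.some.injEq] at hs
      subst hs
      rw [topMark_encInner] at hs'
      subst hs'
      rw [Option.toList_none, List.append_nil]
      obtain ⟨h₁, h₂⟩ := ht
      have h₃ : List.tail (encInner κ ([] : List M.Γ)) =
          encPath M.Γ κ (W.nf (pos W w)).2.toWord := by
        rw [h₂]
        rfl
      rw [List.nil_append, h₃]
      refine .outerPend ?_ ?_ ?_ ?_
      · intro q₁ hq₁
        rw [hq₀, Option.some.injEq] at hq₁
        exact hq₁ ▸ hrun
      · rw [Pending.nil, List.reverse_nil, ← FreeGroup.one_eq_mk, one_mul, ← h₁]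
      · simp [h₂, Pending.nil]
      · rw [h₂, checkWord_length, List.length_reverse]
        omega
    | run_rest hR hs =>
      rw [keep_stackView, Option.toList_none, List.append_nil]
      -- The given machine has just run, so the current position is the target and the relative path
      -- starts out trivial.
      have h₁ : W.nf (pos W w * (pos W w)⁻¹) = (W.t₀, 1) := by
        rw [mul_inv_cancel, W.nf_one]
      have := WreathInv.inner (hM := hM) (κ := κ) (n := n) (w := w) hq₀ ht ⟨hrun, hR⟩ ?_ ?_ ?_
      · rw [h₁] at this
        simpa using this
      · rintro ⟨rfl, rfl⟩
        exact hs ⟨hq₀, topMark_encInner.2 rfl⟩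
      · simp only [h₁, FreeGroup.toWord_one, List.length_nil, Nat.zero_le]
      · simp only [h₁, FreeGroup.toWord_one, List.length_nil, encInner_length, checkWord_length]
        omega
  | @inner q₀ q b p₀ hq₀ ht hrun hne hlen hlen' =>
    obtain ⟨p', w', rfl, hm⟩ := wreath_step hstep
    have hb := run_length_le hP (hd q₀ hq₀) hrun.1
    cases hm with
    | @inner_move _ _ z _ g c hz hc =>
      rw [keep_stackView]
      refine .innerPend hq₀ ht ?_ hne ?_ ?_ hlen'
      · rw [Option.toList_some, hits, WreathData.hitWord_concat_inr hz]
        exact hrun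
      · rw [Option.toList_some, pos, WreathData.endPos_concat_inr hz, mul_assoc]
        exact nf_shift hc
      · have := c.2
        simp only [Option.toList_some, List.length_append, List.length_singleton, mul_add]
        omega
    | @inner_skip _ _ z _ i hz hs =>
      rw [keep_stackView, Option.toList_some]
      have hpos : pos W (w ++ [z]) = pos W w := WreathData.endPos_concat_inl hz
      rw [← hpos] at hlen hlen' ⊢
      refine .inner hq₀ ht ?_ hne (hlen.trans ?_) hlen'
      · rw [hits, WreathData.hitWord_concat_of_notMem hz]
        · exact hrun
        · intro h
          have h₁ : pos W w = p₀ := h.unique ht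
          rw [topRel_iff, h₁, mul_inv_cancel, W.nf_one] at hs
          simp at hs
      · simp only [List.length_append, mul_add]
        omega
    | @inner_read _ _ z _ i m _ _ hz hs hm hw' =>
      obtain ⟨h₁, h₂⟩ := hs
      rw [topRel_iff, not_not] at h₂
      rw [h₂, List.map_nil, List.nil_append] at hm ⊢
      rw [innerView_encInner hb, Option.some.injEq] at hm
      subst hm
      rw [keepMark_encInner, Option.toList_some]
      have hpos : pos W w = p₀ := eq_of_nf_mul_inv h₁ h₂
      have hpos' : pos W (w ++ [z]) = pos W w := WreathData.endPos_concat_inl hz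
      refine .run hq₀ (by rwa [hpos', hpos]) ?_
      rw [hits, WreathData.hitWord_concat_of_mem hz]
      · exact hrun.1.step (step_of_mem hw')
      · change Target W st.2 κ (pos W w)
        rwa [hpos]
  | @innerPend q₀ q b p₀ t f c hq₀ ht hrun hne hnf hlen hlen' =>
    obtain ⟨p', w', rfl, hm⟩ := wreath_step hstep
    cases hm with
    | inner_done hc =>
      rw [keep_stackView, Option.toList_none, List.append_nil]
      rw [hc, List.reverse_nil, ← FreeGroup.one_eq_mk, one_mul] at hnf
      have h₁ : t = (W.nf (pos W w * p₀⁻¹)).1 := by rw [hnf]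
      have h₂ : f = (W.nf (pos W w * p₀⁻¹)).2 := by rw [hnf]
      rw [h₁, h₂]
      rw [h₂] at hlen hlen'
      exact .inner hq₀ ht hrun hne (by omega) hlen'
    | @inner_pop _ _ _ x o y _ c' hc hs hxy =>
      rw [Option.toList_none, List.append_nil]
      cases hf : f.toWord with
      | nil =>
        rw [hf] at hs
        cases b <;> simp [encInner, stackView] at hs
      | cons y' l =>
        rw [hf] at hs
        simp only [List.map_cons, List.cons_append, stackView, Option.some.injEq, Prod.mk.injEq,
          PushSym.rel.injEq] at hs
        rw [← hs.2] at hxy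
        have hl := toWord_mk_mul_of_cancels hf hxy
        simp only [List.nil_append, List.map_cons, List.cons_append, List.tail_cons]
        simp only [hf, hc, List.length_cons] at hlen hlen'
        rw [← hl]
        exact .innerPend hq₀ ht hrun hne (nf_pending hc hnf) (by rw [hl]; omega) (by rw [hl]; omega)
    | @inner_push _ _ _ x _ c' hc hs hxy =>
      rw [Option.toList_none, List.append_nil, List.cons_append, keep_stackView]
      have hl : (FreeGroup.mk [x] * f).toWord = x :: f.toWord := by
        refine toWord_mk_mul_of_not_cancels fun y l hf => ?_
        rw [hf] at hxy
        exact hxy _ _ rfl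
      rw [canPush_iff, List.length_append, List.length_map] at hs
      have : PushSym.rel x :: (f.toWord.map .rel ++ encInner κ b) =
          (FreeGroup.mk [x] * f).toWord.map .rel ++ encInner κ b := by
        rw [hl]
        rfl
      rw [this]
      simp only [hc, List.length_cons] at hlen
      exact .innerPend hq₀ ht hrun hne (nf_pending hc hnf) (by rw [hl, List.length_cons]; omega)
        (by rw [hl, List.length_cons]; omega)

theorem WreathInv.of_run (hP : M.IsPre R L) (hd : ∀ q₀, st.1 = some q₀ → d ∈ M.entry q₀)
    {w : List 𝒜} {D : (wreath W hM).Config}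
    (h : (wreath W hM).Run (wreathConfig hM st (checkWord κ d n) (.outer W.t₀ true) []) w D) :
    WreathInv hM st κ d n w D := by
  have h₀ : WreathInv hM st κ d n []
      (wreathConfig hM st (checkWord κ d n) (.outer W.t₀ true) []) := by
    have h₁ : W.nf (pos W []) = (W.t₀, 1) := W.nf_one
    have := WreathInv.outer (hM := hM) (st := st) (κ := κ) (d := d) (n := n) (w := [])
      (fun _ _ => .refl _) (by simp [h₁]) (by simp [h₁])
    rw [h₁] at this
    simpa [encPath] using this
  simpa using h.invariant (fun w C a D hC hD => hC.step hP hd hD) h₀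

theorem WreathInv.length_le (hP : M.IsPre R L) (hd : ∀ q₀, st.1 = some q₀ → d ∈ M.entry q₀)
    {w : List 𝒜} {D : (wreath W hM).Config} (h : WreathInv hM st κ d n w D) :
    D.pushdown.length ≤ D.check.length := by
  cases h with
  | outer _ _ h => exact (encPath_length _ _).trans_le h
  | outerPend _ _ _ h => exact (encPath_length _ _).trans_le h
  -- The probing mark was pushed without a test for room. The path below it is a prefix of `κ`, and
  -- the check stack has at least two symbols more than `κ`.
  | probe _ _ hf =>
    have := hf.length_le
    rw [List.length_reverse] at this
    refine (congrArg (· + 1) (encPath_length _ _)).trans_le ?_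
    refine le_trans ?_ checkWord_length.ge
    omega
  | run hq₀ _ hrun =>
    have := run_length_le hP (hd _ hq₀) hrun
    refine (encInner_length _ _).trans_le (le_trans ?_ checkWord_length.ge)
    omega
  | inner _ _ _ _ _ h => exact (List.length_append.trans (congrArg (· + _) (List.length_map _))).trans_le h
  | innerPend _ _ _ _ _ _ h => exact (List.length_append.trans (congrArg (· + _) (List.length_map _))).trans_le h

/-- Silent moves of the machine for the wreath product. -/
abbrev WreathAcc (C : (wreath W hM).Config) : Prop :=
  Acc (fun E D => (wreath W hM).Step D none E) C

theorem wreath_acc_reading {C : (wreath W hM).Config} (h : C.state ∈ wreathReading W hM) :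
    WreathAcc C :=
  ⟨_, fun _ hD => absurd h (wreath_isDet.not_reading_of_step hD)⟩

/-- Every silent move either shortens the pending word or ends in a reading state. -/
theorem wreath_acc_outerPend {l t σ} {c : Pending W} :
    WreathAcc (wreathConfig hM st l (.outerPend t c) σ) := by
  obtain ⟨k, hk⟩ : ∃ k, c.1.length = k := ⟨_, rfl⟩
  induction k generalizing c σ with
  | zero =>
    refine ⟨_, fun D hD => ?_⟩
    obtain ⟨p', w', rfl, hm⟩ := wreath_step hD
    cases hm with
    | outer_done => exact wreath_acc_reading (.inl ⟨_, _, rfl⟩)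
    | outer_pop hc => rw [hc] at hk; cases hk
    | outer_push hc => rw [hc] at hk; cases hk
  | succ k ih =>
    refine ⟨_, fun D hD => ?_⟩
    obtain ⟨p', w', rfl, hm⟩ := wreath_step hD
    cases hm with
    | outer_done => exact wreath_acc_reading (.inl ⟨_, _, rfl⟩)
    | outer_pop hc => exact ih (by simpa [hc] using hk)
    | outer_push hc => exact ih (by simpa [hc] using hk)

theorem wreath_acc_innerPend {l q t σ} {c : Pending W} :
    WreathAcc (wreathConfig hM st l (.innerPend q t c) σ) := by
  obtain ⟨k, hk⟩ : ∃ k, c.1.length = k := ⟨_, rfl⟩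
  induction k generalizing c σ with
  | zero =>
    refine ⟨_, fun D hD => ?_⟩
    obtain ⟨p', w', rfl, hm⟩ := wreath_step hD
    cases hm with
    | inner_done => exact wreath_acc_reading (.inr ⟨_, _, rfl⟩)
    | inner_pop hc => rw [hc] at hk; cases hk
    | inner_push hc => rw [hc] at hk; cases hk
  | succ k ih =>
    refine ⟨_, fun D hD => ?_⟩
    obtain ⟨p', w', rfl, hm⟩ := wreath_step hD
    cases hm with
    | inner_done => exact wreath_acc_reading (.inr ⟨_, _, rfl⟩)
    | inner_pop hc => exact ih (by simpa [hc] using hk)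
    | inner_push hc => exact ih (by simpa [hc] using hk)

/-- The induction is along the silent moves of `M`, which terminate on reachable configurations:
each move in this mode mirrors one of them or leaves the mode. -/
theorem wreath_acc_run (hP : M.IsPre R L) {q₀ : M.Q} (hd : d ∈ M.entry q₀) {w : List A}
    {C : M.Config} (hC : M.Run ⟨q₀, d, []⟩ w C) :
    WreathAcc (wreathConfig hM st (checkWord κ d n) (.run C.state) (encInner κ C.pushdown)) := by
  induction hP.terminates _ _ _ ⟨hd, rfl⟩ hC with
  | intro C _ ih =>
    obtain ⟨q, d', a⟩ := C
    obtain rfl : d' = d := hC.check_eq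
    refine ⟨_, fun D hD => ?_⟩
    obtain ⟨p', w', rfl, hm⟩ := wreath_step hD
    cases hm with
    | run_silent hs hw' =>
      rw [innerView_encInner (run_length_le hP hd hC), Option.some.injEq] at hs
      subst hs
      rw [keepMark_encInner]
      exact ih _ (step_of_mem hw') (by simpa using hC.step (step_of_mem hw'))
    | run_init => exact wreath_acc_outerPend
    | run_rest => exact wreath_acc_reading (.inr ⟨_, _, rfl⟩)

theorem WreathInv.acc (hP : M.IsPre R L) (hd : ∀ q₀, st.1 = some q₀ → d ∈ M.entry q₀)
    {w : List 𝒜} {D : (wreath W hM).Config} (h : WreathInv hM st κ d n w D) : WreathAcc D := by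
  cases h with
  | outer => exact wreath_acc_reading (.inl ⟨_, _, rfl⟩)
  | inner => exact wreath_acc_reading (.inr ⟨_, _, rfl⟩)
  | outerPend => exact wreath_acc_outerPend
  | innerPend => exact wreath_acc_innerPend
  | run hq₀ _ hrun => exact wreath_acc_run hP (hd _ hq₀) hrun
  | @probe i q₀ f h hq₀ hnf hf hrun hhit hmiss =>
    refine ⟨_, fun D hD => ?_⟩
    have hinv := (WreathInv.probe hq₀ hnf hf hrun hhit hmiss).step hP hd hD
    obtain ⟨p', w', rfl, hm⟩ := wreath_step hD
    cases hm with
    | probe_miss => exact wreath_acc_outerPend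
    | @probe_hit _ _ _ _ q' w' hs hq₁ hw' =>
      rw [hq₀, Option.some.injEq] at hq₁
      subst hq₁
      -- The invariant after the move presents the new stack as the encoding of a configuration that
      -- `M` reaches, as `wreath_acc_run` requires.
      generalize hC : wreathConfig hM st (checkWord κ d n) (.run q') _ = C at hinv
      cases hinv with
      | run hq₁ _ hrun =>
        exact wreath_acc_run hP (hd _ hq₁) hrun
      | _ => exact absurd (congrArg (fun C : (wreath W hM).Config => C.state.2) hC) nofun

/-- The configurations in reading states. -/
theorem WreathInv.of_reading {w : List 𝒜} {D : (wreath W hM).Config}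
    (h : WreathInv hM st κ d n w D) (hD : D.state ∈ wreathReading W hM) :
    ((∀ q₀, st.1 = some q₀ → M.Run ⟨q₀, d, []⟩ (hits W st.2 κ w) ⟨q₀, d, []⟩) ∧
      D = wreathConfig hM st (checkWord κ d n)
        (.outer (W.nf (pos W w)).1 (decide ((W.nf (pos W w)).2 = 1)))
        (encPath M.Γ κ (W.nf (pos W w)).2.toWord)) ∨
    (∃ q₀ q a p₀, st.1 = some q₀ ∧ Target W st.2 κ p₀ ∧
      M.After R ⟨q₀, d, []⟩ (hits W st.2 κ w) ⟨q, d, a⟩ ∧ ¬ (q = q₀ ∧ a = []) ∧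
      D = wreathConfig hM st (checkWord κ d n) (.inner q (W.nf (pos W w * p₀⁻¹)).1)
        ((W.nf (pos W w * p₀⁻¹)).2.toWord.map .rel ++ encInner κ a)) := by
  cases h with
  | outer h => exact .inl ⟨h, rfl⟩
  | inner h₁ h₂ h₃ h₄ => exact .inr ⟨_, _, _, _, h₁, h₂, h₃, h₄, rfl⟩
  | _ => rcases hD with ⟨_, _, h⟩ | ⟨_, _, h⟩ <;> cases h

/-- There are two dangers: lack of room for a push, excluded by the padding, and a blocked
simulation, excluded because the given machine gets through all letters passed on to it. -/
theorem WreathInv.exists_step (hP : M.IsPre R L) (hd : ∀ q₀, st.1 = some q₀ → d ∈ M.entry q₀)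
    {w : List 𝒜} {C : (wreath W hM).Config} (hinv : WreathInv hM st κ d n w C)
    (hn : W.N * w.length ≤ n) (hw : ∀ q₀, st.1 = some q₀ →
      ∃ E, M.After R ⟨q₀, d, []⟩ (hits W st.2 κ w) E) (hC : C.state ∉ wreathReading W hM) :
    ∃ D, (wreath W hM).Step C none D := by
  cases hinv with
  | outer => exact absurd (.inl ⟨_, _, rfl⟩) hC
  | inner => exact absurd (.inr ⟨_, _, rfl⟩) hC
  | @outerPend t f c hrun hnf hlen hlen' =>
    obtain ⟨_ | ⟨x, c⟩, hc⟩ := c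
    · exact ⟨_, wreath_step_of_move (.outer_done rfl)⟩
    · have hc' : c.length ≤ W.N := (Nat.le_succ _).trans hc
      by_cases h : ∃ o y b, stackView (checkWord κ d n) (encPath M.Γ κ f.toWord) =
          some (o, .path y b) ∧ Cancels x y
      · obtain ⟨o, y, b, h₁, h₂⟩ := h
        exact ⟨_, wreath_step_of_move (.outer_pop (c' := ⟨c, hc'⟩) rfl h₁ h₂)⟩
      · refine ⟨_, wreath_step_of_move (.outer_push (c' := ⟨c, hc'⟩) rfl ?_
          fun o y b h₁ h₂ => h ⟨o, y, b, h₁, h₂⟩)⟩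
        rw [canPush_iff, encPath_length, checkWord_length]
        simp only [List.length_cons] at hlen
        omega
  | @innerPend q₀ q b p₀ t f c hq₀ ht hrun hne hnf hlen hlen' =>
    obtain ⟨_ | ⟨x, c⟩, hc⟩ := c
    · exact ⟨_, wreath_step_of_move (.inner_done rfl)⟩
    · have hc' : c.length ≤ W.N := (Nat.le_succ _).trans hc
      by_cases h : ∃ o y, stackView (checkWord κ d n) (f.toWord.map .rel ++ encInner κ b) =
          some (o, .rel y) ∧ Cancels x y
      · obtain ⟨o, y, h₁, h₂⟩ := h
        exact ⟨_, wreath_step_of_move (.inner_pop (c' := ⟨c, hc'⟩) rfl h₁ h₂)⟩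
      · refine ⟨_, wreath_step_of_move (.inner_push (c' := ⟨c, hc'⟩) rfl ?_
          fun o y h₁ h₂ => h ⟨o, y, h₁, h₂⟩)⟩
        have := run_length_le hP (hd _ hq₀) hrun.1
        rw [canPush_iff, List.length_append, List.length_map, encInner_length, checkWord_length]
        simp only [List.length_cons] at hlen
        omega
  | @probe i q₀ f h hq₀ hnf hf hrun hhit hmiss =>
    by_cases hf' : f.toWord = κ.reverse
    · obtain ⟨E, hE⟩ := hw q₀ hq₀
      rw [hhit hf'] at hE
      obtain ⟨D, w', hw', -⟩ := hM.exists_read_of_after ⟨hrun, hP.entry_reading _ ⟨hd _ hq₀, rfl⟩⟩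
        hE.1
      refine ⟨_, wreath_step_of_move (.probe_hit (g := .mark) ?_ hq₀ hw')⟩
      rw [stackView, encPath_length, hf', List.length_reverse, checkWord_getElem?_mark]
    · refine ⟨_, wreath_step_of_move (.probe_miss fun g hg => hf' ?_)⟩
      have hle := hf.length_le
      rw [List.length_reverse] at hle
      rcases hle.lt_or_eq with hlt | heq
      · simp only [stackView, encPath_length, Option.some.injEq, Prod.mk.injEq] at hg
        rw [checkWord_getElem?_path hlt] at hg
        simp at hg
      · rw [← hf.eq_of_length (by simpa using heq), List.reverse_reverse]
  | @run q₀ q b hq₀ ht hrun =>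
    by_cases hR : q ∈ R
    · by_cases h : st.1 = some q ∧ TopMark (stackView (checkWord κ d n) (encInner κ b))
      · exact ⟨_, wreath_step_of_move (.run_init hR h)⟩
      · exact ⟨_, wreath_step_of_move (.run_rest hR h)⟩
    · obtain ⟨E, hE⟩ := hw q₀ hq₀
      obtain ⟨D, w', hw', -⟩ := hM.exists_step_of_after hrun hE hR
      rw [Config.view_eq] at hw'
      exact ⟨_, wreath_step_of_move
        (.run_silent (innerView_encInner (run_length_le hP (hd _ hq₀) hrun)) hw')⟩

end CSPDA

/-! ### Correctness of the machine for the wreath product. -/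

namespace CSPDA

variable {𝒜 : Type u} {A : Type w} {K : Type v} [Group K]
variable {W : WreathData 𝒜 A K} {M : CSPDA A} {R : Set M.Q} {L : Language A} {hM : M.IsDet R}
  {st : Option M.Q × W.T} {κ : List (W.X × Bool)} {d : List M.Δ} {n : ℕ}

theorem wreath_exists_after (hP : M.IsPre R L) (hd : ∀ q₀, st.1 = some q₀ → d ∈ M.entry q₀)
    {w : List 𝒜} (hn : W.N * w.length ≤ n) (hw : ∀ q₀, st.1 = some q₀ →
      ∃ E, M.After R ⟨q₀, d, []⟩ (hits W st.2 κ w) E) :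
    ∃ D, (wreath W hM).After (wreathReading W hM)
      (wreathConfig hM st (checkWord κ d n) (.outer W.t₀ true) []) w D := by
  induction w using List.reverseRecOn with
  | nil => exact ⟨_, .refl _, .inl ⟨_, _, rfl⟩⟩
  | append_singleton w z ih =>
    obtain ⟨D, hD⟩ : ∃ D, (wreath W hM).After (wreathReading W hM)
        (wreathConfig hM st (checkWord κ d n) (.outer W.t₀ true) []) w D := by
      refine ih (le_trans ?_ hn) fun q₀ hq₀ => ?_
      · simp [mul_add]
      · obtain ⟨E, hE⟩ := hw q₀ hq₀
        rw [hits, WreathData.hitWord_append] at hE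
        obtain ⟨E', hE', -⟩ := hM.after_of_append hE.1 (.inr hE.2)
        exact ⟨E', hE'⟩
    have hstep : ∃ D', (wreath W hM).Step D (some z) D' := by
      rcases (WreathInv.of_run hP hd hD.1).of_reading hD.2 with
        ⟨hrun, rfl⟩ | ⟨q₀, q, a, p₀, hq₀, ht, hrun, hne, rfl⟩
      · cases hz : W.act z with
        | inl i =>
          by_cases h : st.1.isSome = true ∧ (W.nf (pos W w)).1 = st.2 ∧ onPath (stackView
              (checkWord κ d n) (encPath M.Γ κ (W.nf (pos W w)).2.toWord)) = true
          · exact ⟨_, wreath_step_of_move (.outer_probe hz h)⟩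
          · exact ⟨_, wreath_step_of_move (.outer_skip hz h)⟩
        | inr g =>
          exact ⟨_, wreath_step_of_move (.outer_move (c := ⟨List.reverse _, by
            rw [List.length_reverse]; exact W.bound z g hz _⟩) hz rfl)⟩
      · cases hz : W.act z with
        | inl i =>
          by_cases h : (W.nf (pos W w * p₀⁻¹)).1 = W.t₀ ∧ ¬ TopRel (stackView (checkWord κ d n)
              ((W.nf (pos W w * p₀⁻¹)).2.toWord.map .rel ++ encInner κ a))
          · obtain ⟨E, hE⟩ := hw q₀ hq₀
            have h₁ := h.2
            rw [topRel_iff, not_not] at h₁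
            have hpos : pos W w = p₀ := eq_of_nf_mul_inv h.1 h₁
            rw [hits, WreathData.hitWord_concat_of_mem hz
              (show Target W st.2 κ (pos W w) by rwa [hpos])] at hE
            obtain ⟨F, w', hw', -⟩ := hM.exists_read_of_after hrun hE.1
            rw [Config.view_eq] at hw'
            refine ⟨_, wreath_step_of_move (.inner_read hz h ?_ hw')⟩
            rw [h₁, List.map_nil, List.nil_append]
            exact innerView_encInner (run_length_le hP (hd _ hq₀) hrun.1)
          · exact ⟨_, wreath_step_of_move (.inner_skip hz h)⟩
        | inr g =>
          exact ⟨_, wreath_step_of_move (.inner_move (c := ⟨List.reverse _, by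
            rw [List.length_reverse]; exact W.bound z g hz _⟩) hz rfl)⟩
    obtain ⟨D', hD'⟩ := hstep
    have hrun := hD.1.step hD'
    have hinv := WreathInv.of_run hP hd hrun
    obtain ⟨E, hE, -⟩ := exists_run_nil_reading (R := wreathReading W hM)
      (P := WreathInv hM st κ d n (w ++ [z])) (fun C hC hR => by
        obtain ⟨D, hD⟩ := hC.exists_step hP hd hn hw hR
        exact ⟨D, hD, by simpa using hC.step hP hd hD⟩) (hinv.acc hP hd) hinv
    exact ⟨E, by simpa using hrun.append hE.1, hE.2⟩

theorem wreath_isEntry {C : (wreath W hM).Config} (h : (wreath W hM).IsEntry C) :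
    ∃ st κ d n, (∀ q₀, st.1 = some q₀ → d ∈ M.entry q₀) ∧
      C = wreathConfig hM st (checkWord κ d n) (.outer W.t₀ true) [] := by
  obtain ⟨⟨st, p⟩, l, σ⟩ := C
  obtain ⟨⟨h₁, κ, d, n, h₂, h₃⟩, h₄⟩ := h
  dsimp only at h₁ h₂ h₃ h₄
  subst h₁ h₃ h₄
  refine ⟨st, κ, d, n, fun q₀ hq₀ => ?_, rfl⟩
  rw [hq₀] at h₂
  exact h₂

theorem isEntry_wreathConfig (h : ∀ q₀, st.1 = some q₀ → d ∈ M.entry q₀) :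
    (wreath W hM).IsEntry (wreathConfig hM st (checkWord κ d n) (.outer W.t₀ true) []) := by
  refine ⟨⟨rfl, κ, d, n, ?_, rfl⟩, rfl⟩
  obtain ⟨_ | q, t⟩ := st
  · exact id
  · exact h q rfl

/-- The guessed `κ` may fail to be reduced; it then describes no position, and no letter is ever
passed on. -/
theorem target_eq_or (t : W.T) (κ : List (W.X × Bool)) :
    (∃ k, Target W t κ = (· = k)) ∨ ∀ k, ¬ Target W t κ k := by
  by_cases h : ∃ k, Target W t κ k
  · obtain ⟨k, hk⟩ := h
    exact .inl ⟨k, funext fun p => propext ⟨fun hp => hp.unique hk, fun hp => hp ▸ hk⟩⟩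
  · exact .inr (not_exists.1 h)

theorem wreath_isPre {H : Type*} [Group H] {ev : A → H} {L' : Language 𝒜} (hP : M.IsPre R L)
    (hacc : M.accept ⊆ R) (hL : ∀ u, u ∈ L ↔ (u.map ev).prod ≠ 1)
    (hL' : ∀ w, w ∈ L' ↔ W.endPos 1 w ≠ 1 ∨
      ∃ k, ((W.hitWord (· = k) 1 w).map ev).prod ≠ 1) :
    (wreath W hP.toIsDet).IsPre (wreathReading W hP.toIsDet) L' where
  toIsDet := wreath_isDet
  terminates C D w hC hr := by
    obtain ⟨st, κ, d, n, hd, rfl⟩ := wreath_isEntry hC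
    exact (WreathInv.of_run hP hd hr).acc hP hd
  entry_reading C hC := by
    obtain ⟨st, κ, d, n, hd, rfl⟩ := wreath_isEntry hC
    exact .inl ⟨_, _, rfl⟩
  bounded C D w hC hr := by
    obtain ⟨st, κ, d, n, hd, rfl⟩ := wreath_isEntry hC
    exact (WreathInv.of_run hP hd hr).length_le hP hd
  ignores C hC u v hv D E hD hE := by
    obtain ⟨st, κ, d, n, hd, rfl⟩ := wreath_isEntry hC
    have hD' := (WreathInv.of_run hP hd hD.1).of_reading hD.2
    have hE' := (WreathInv.of_run hP hd hE.1).of_reading hE.2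
    rw [hL', not_or, not_not, not_exists] at hv
    obtain ⟨hv₁, hv₂⟩ := hv
    have hpos : pos W (u ++ v) = pos W u := by
      rw [pos, WreathData.endPos_append, WreathData.endPos_eq_mul, hv₁, one_mul]
      rfl
    obtain ⟨v', hv', hhits⟩ : ∃ v', v' ∉ L ∧
        hits W st.2 κ (u ++ v) = hits W st.2 κ u ++ v' := by
      refine ⟨_, ?_, WreathData.hitWord_append _ _ _ _⟩
      rw [WreathData.hitWord_translate, hL, not_not]
      rcases target_eq_or st.2 κ with ⟨k, hk⟩ | hk
      -- Seen from the position reached after `u`, the target is `k * (W.endPos 1 u)⁻¹`. So `v'`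
      -- evaluates to a coordinate of `v`, which is trivial.
      · have : (fun p => Target W st.2 κ (p * W.endPos 1 u)) = (· = k * (W.endPos 1 u)⁻¹) := by
          funext p
          rw [hk, eq_mul_inv_iff_mul_eq]
        rw [this]
        exact not_not.1 (hv₂ _)
      · rw [WreathData.hitWord_eq_nil fun k => hk _]
        rfl
    rw [hpos, hhits] at hE'
    have key : ∀ {q₀ E F}, st.1 = some q₀ → M.After R ⟨q₀, d, []⟩ (hits W st.2 κ u) E →
        M.After R ⟨q₀, d, []⟩ (hits W st.2 κ u ++ v') F → F = E :=
      fun hq₀ => hP.ignores _ ⟨hd _ hq₀, rfl⟩ _ _ hv' _ _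
    rcases hD' with ⟨hrun, rfl⟩ | ⟨q₀, q, a, p₀, hq₀, ht, hrun, hne, rfl⟩ <;>
      rcases hE' with ⟨hrun', rfl⟩ | ⟨q₀', q', a', p₀', hq₀', ht', hrun', hne', rfl⟩
    · rfl
    -- The modes cannot differ: property (3) of `M` would identify its entry configuration with one
    -- that inner mode excludes.
    · have := key hq₀' ⟨hrun _ hq₀', hP.entry_reading _ ⟨hd _ hq₀', rfl⟩⟩ hrun'
      simp only [CSPDA.Config.mk.injEq] at this
      exact absurd ⟨this.1, this.2.2⟩ hne'
    · have := key hq₀ hrun ⟨hrun' _ hq₀, hP.entry_reading _ ⟨hd _ hq₀, rfl⟩⟩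
      simp only [CSPDA.Config.mk.injEq] at this
      exact absurd ⟨this.1.symm, this.2.2.symm⟩ hne
    · obtain rfl := ht.unique ht'
      rw [hq₀, Option.some.injEq] at hq₀'
      subst hq₀'
      cases key hq₀ hrun hrun'
      rfl
  language_eq := by
    ext w
    rw [hL']
    constructor
    · rintro ⟨C, D, hC, hr, hD⟩
      obtain ⟨st, κ, d, n, hd, rfl⟩ := wreath_isEntry hC
      have hR : D.state ∈ wreathReading W hP.toIsDet := by
        rcases hD with ⟨t, e, h, -⟩ | ⟨q, t, h, -⟩
        · exact .inl ⟨t, e, h⟩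
        · exact .inr ⟨q, t, h⟩
      rcases (WreathInv.of_run hP hd hr).of_reading hR with
        ⟨hrun, rfl⟩ | ⟨q₀, q, a, p₀, hq₀, ht, hrun, hne, rfl⟩
      · left
        intro hpos
        have hpos : W.nf (pos W w) = (W.t₀, 1) := by rw [pos, hpos, W.nf_one]
        rcases hD with ⟨t, e, h, h'⟩ | ⟨q, t, h, -⟩
        · simp only [wreathConfig, hpos, WreathCore.outer.injEq, decide_true] at h
          rcases h' with h' | h'
          · exact h' h.1.symm
          · rw [← h.2] at h'
            cases h'
        · cases h
      · right
        rcases hD with ⟨t, e, h, h'⟩ | ⟨q', t, h, hq'⟩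
        · cases h
        · cases h
          have hmem : hits W st.2 κ w ∈ L := hP.language_eq ▸ ⟨_, _, ⟨hd _ hq₀, rfl⟩, hrun.1, hq'⟩
          rw [hL] at hmem
          rcases target_eq_or st.2 κ with ⟨k, hk⟩ | hk
          · rw [hits, hk] at hmem
            exact ⟨k, hmem⟩
          · exact absurd ht (hk _)
    · rintro (hw | ⟨k, hk⟩)
      · have hd : ∀ q₀, ((none, W.t₀) : Option M.Q × W.T).1 = some q₀ → [] ∈ M.entry q₀ := by
          rintro _ ⟨⟩
        obtain ⟨D, hD⟩ := wreath_exists_after (hM := hP.toIsDet) (st := (none, W.t₀)) (κ := [])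
          (d := []) (w := w) hP hd le_rfl (by rintro _ ⟨⟩)
        refine ⟨_, D, isEntry_wreathConfig hd, hD.1, ?_⟩
        rcases (WreathInv.of_run hP hd hD.1).of_reading hD.2 with
          ⟨hrun, rfl⟩ | ⟨q₀, q, a, p₀, hq₀, -⟩
        · refine .inl ⟨_, _, rfl, ?_⟩
          by_contra h
          rw [not_or, not_not, Bool.not_eq_false, decide_eq_true_iff] at h
          exact hw (W.nf.injective ((Prod.ext h.1 h.2).trans W.nf_one.symm))
        · cases hq₀
      -- Check stacks are listed from the bottom and reduced words from the top of the pushdown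
      -- stack, hence the reversal.
      · set κ := (W.nf k).2.toWord.reverse
        have htar : Target W (W.nf k).1 κ = (· = k) := by
          have hk : Target W (W.nf k).1 κ k := ⟨rfl, (List.reverse_reverse _).symm⟩
          exact funext fun p => propext ⟨fun hp => hp.unique hk, fun hp => hp ▸ hk⟩
        have hmem : hits W (W.nf k).1 κ w ∈ L := by rwa [hits, htar, hL]
        have hmem' := hmem
        rw [← hP.language_eq] at hmem'
        obtain ⟨⟨q₀, d, σ⟩, E, ⟨hd, hσ⟩, hr, hE⟩ := hmem'
        obtain rfl : σ = [] := hσ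
        have hd' : ∀ q₁, (some q₀, (W.nf k).1).1 = some q₁ → d ∈ M.entry q₁ := by
          rintro _ ⟨⟩
          exact hd
        have hA : M.After R ⟨q₀, d, []⟩ (hits W (W.nf k).1 κ w) E := ⟨hr, hacc hE⟩
        -- The padding is fixed by `le_rfl`: `W.N` symbols for each input letter.
        obtain ⟨D, hD⟩ := wreath_exists_after (hM := hP.toIsDet) (st := (some q₀, (W.nf k).1))
          (κ := κ) (d := d) (w := w) hP hd' le_rfl (by rintro _ ⟨⟩; exact ⟨E, hA⟩)
        refine ⟨_, D, isEntry_wreathConfig hd', hD.1, ?_⟩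
        rcases (WreathInv.of_run hP hd' hD.1).of_reading hD.2 with
          ⟨hrun, rfl⟩ | ⟨q₁, q, a, p₀, hq₁, ht, hrun, hne, rfl⟩
        -- Ending in outer mode would make the entry configuration accepting, so the empty word
        -- would lie in `L`.
        · have h₁ := hP.after_unique hA ⟨hrun q₀ rfl, hP.entry_reading _ ⟨hd, rfl⟩⟩
          have h₂ : ([] : List A) ∈ L :=
            hP.language_eq ▸ ⟨_, _, ⟨hd, rfl⟩, .refl _, h₁ ▸ hE⟩
          rw [hL] at h₂
          exact absurd rfl h₂
        · obtain rfl : q₀ = q₁ := Option.some.inj hq₁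
          refine .inr ⟨_, _, rfl, ?_⟩
          have := hP.after_unique hrun hA
          rwa [this] at hE

end CSPDA

/-! ### Normal forms in virtually free groups. -/

/-- Each `x` gives a homomorphism to the group of order two that detects only `x`. These are
pairwise distinct, and each is determined by its values on a finite generating set, so there are
finitely many. -/
theorem FreeGroup.finite_of_fg {X : Type*} [h : Group.FG (FreeGroup X)] : Finite X := by
  classical
  obtain ⟨S, hS⟩ := Group.fg_def.1 h
  let c : Multiplicative (ZMod 2) := .ofAdd 1
  have hc : c ≠ 1 := by decide
  refine Finite.of_injective
    (fun x (s : S) => FreeGroup.lift (Pi.mulSingle (M := fun _ : X => Multiplicative (ZMod 2)) x c)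
      s.1) fun x y hxy => ?_
  have h₁ : FreeGroup.lift (Pi.mulSingle (M := fun _ : X => Multiplicative (ZMod 2)) x c) =
      FreeGroup.lift (Pi.mulSingle (M := fun _ : X => Multiplicative (ZMod 2)) y c) :=
    MonoidHom.eq_of_eqOn_dense hS fun s hs => congrFun hxy ⟨s, hs⟩
  have h₂ := congrFun (FreeGroup.lift.injective h₁) x
  rw [Pi.mulSingle_eq_same] at h₂
  by_contra hne
  rw [Pi.mulSingle_eq_of_ne hne] at h₂
  exact hc h₂

/-- A finitely generated virtually free group has normal forms. -/
theorem IsVirtuallyFree.exists_freeCosets {K : Type v} [Group K] (hfg : Group.FG K)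
    (hK : IsVirtuallyFree K) : Nonempty (FreeCosets K) := by
  obtain ⟨F, hF, hfree⟩ := hK
  have hFG : Group.FG F := inferInstance
  have hFG' : Group.FG (FreeGroup (IsFreeGroup.Generators F)) :=
    Group.fg_of_surjective (f := (IsFreeGroup.toFreeGroup F).toMonoidHom)
      (IsFreeGroup.toFreeGroup F).surjective
  have := FreeGroup.finite_of_fg (X := IsFreeGroup.Generators F)
  obtain ⟨m, ⟨eX⟩⟩ := Finite.exists_equiv_fin (IsFreeGroup.Generators F)
  let e : F ≃* FreeGroup (Fin m) :=
    (IsFreeGroup.toFreeGroup F).trans (FreeGroup.freeGroupCongr eX)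
  obtain ⟨S, hS, h1⟩ := F.exists_isComplement_left 1
  have : Finite S := hS.finite_left
  obtain ⟨r, ⟨eS⟩⟩ := Finite.exists_equiv_fin S
  refine ⟨⟨Fin m, Fin r, hS.equiv.trans (eS.prodCongr e.toEquiv), eS ⟨1, h1⟩, ?_, ?_⟩⟩
  · simp [hS.equiv_one h1 F.one_mem]
  · intro g p
    -- Write `p` as a representative times an element of `F`. Right multiplication by that element
    -- changes only the factor in `F`.
    have hp : p = (hS.equiv.symm ((hS.equiv p).1, 1) : K) * ((hS.equiv p).2 : F) := by
      rw [Subgroup.IsComplement.equiv_symm_apply, Subgroup.coe_one, mul_one,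
        Subgroup.IsComplement.equiv_fst_mul_equiv_snd]
    conv_lhs => rw [hp, ← mul_assoc]
    simp [hS.equiv_mul_right]

/-! ### Generators and word problem of the wreath product. -/

section Wreath

variable {H : Type u} {K : Type v} [Group H] [Group K]

/-- The elements of the factor at `1` of the base group. -/
noncomputable def wreathSingle (K : Type v) [Group K] [DecidableEq K] :
    H →* restrictedWreathProduct H K where
  toFun h := ⟨⟨Pi.mulSingle 1 h, 1⟩, (Set.finite_singleton 1).subset Pi.mulSupport_mulSingle_subset⟩
  map_one' := by
    ext <;> simp
  map_mul' a b := by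
    ext <;> simp [Pi.mulSingle_mul]

/-- The elements of the complement of the base group. -/
def wreathInl (H : Type u) [Group H] : K →* restrictedWreathProduct H K :=
  RegularWreathProduct.inl.codRestrict _ fun k => by simp [restrictedWreathProduct]

theorem wreathInl_left (k : K) : (wreathInl H k).1.left = 1 := rfl

theorem wreathInl_right (k : K) : (wreathInl H k).1.right = k := rfl

variable [DecidableEq K]

theorem wreathSingle_left (h : H) : (wreathSingle K h).1.left = Pi.mulSingle 1 h := rfl

theorem wreathSingle_right (h : H) : (wreathSingle K h).1.right = 1 := rfl

theorem closure_wreath_eq_top {A : Set H} {B : Set K} (hA : Subgroup.closure A = ⊤)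
    (hB : Subgroup.closure B = ⊤) :
    Subgroup.closure (wreathSingle K '' A ∪ wreathInl H '' B) = ⊤ := by
  set C := Subgroup.closure (wreathSingle K '' A ∪ wreathInl H '' B)
  have hH : ∀ h, wreathSingle K h ∈ C := by
    intro h
    have : Subgroup.closure A ≤ C.comap (wreathSingle K) := (Subgroup.closure_le _).2
      fun a ha => Subgroup.subset_closure (.inl ⟨a, ha, rfl⟩)
    rw [hA] at this
    exact this (Subgroup.mem_top h)
  have hK : ∀ k, wreathInl H k ∈ C := by
    intro k
    have : Subgroup.closure B ≤ C.comap (wreathInl H) := (Subgroup.closure_le _).2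
      fun b hb => Subgroup.subset_closure (.inr ⟨b, hb, rfl⟩)
    rw [hB] at this
    exact this (Subgroup.mem_top k)
  have hbase : ∀ (s : Finset K) (x : restrictedWreathProduct H K), x.1.right = 1 →
      (∀ k ∉ s, x.1.left k = 1) → x ∈ C := by
    intro s
    induction s using Finset.induction with
    | empty =>
      intro x hx hs
      have : x = 1 := Subtype.ext (RegularWreathProduct.ext
        (funext fun k => hs k (Finset.notMem_empty k)) hx)
      rw [this]
      exact C.one_mem
    | insert k s hk ih =>
      intro x hx hs
      -- Conjugation moves the factor at `1` to `k`. So `y` carries the value of `x` at `k`, and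
      -- dividing by it removes `k` from the support.
      set y := wreathInl H k * wreathSingle K (x.1.left k) * (wreathInl H k)⁻¹
      have hy : y ∈ C := C.mul_mem (C.mul_mem (hK k) (hH _)) (C.inv_mem (hK k))
      have hyr : y.1.right = 1 := by
        change k * 1 * k⁻¹ = 1
        simp
      have hyl : ∀ k', y.1.left k' = if k' = k then x.1.left k else 1 := by
        intro k'
        change (1 : H) * Pi.mulSingle (M := fun _ : K => H) 1 (x.1.left k) (k⁻¹ * k') * (1 : H)⁻¹ = _
        simp [Pi.mulSingle_apply, inv_mul_eq_one, eq_comm]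
      have hyx : y⁻¹ * x ∈ C := by
        refine ih _ ?_ fun k' hk' => ?_
        · change y.1.right⁻¹ * x.1.right = 1
          rw [hyr, hx, inv_one, one_mul]
        · change (y.1.left (y.1.right * k'))⁻¹ * x.1.left (y.1.right⁻¹⁻¹ * k') = 1
          rw [hyr, inv_one, inv_one, one_mul, hyl]
          split_ifs with h
          · rw [h, inv_mul_cancel]
          · rw [inv_one, one_mul]
            exact hs k' fun h' => (Finset.mem_insert.1 h').elim h hk'
      simpa using C.mul_mem hy hyx
  refine (Subgroup.eq_top_iff' C).2 fun x => ?_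
  have hx : x * (wreathInl H x.1.right)⁻¹ ∈ C := by
    have hfin : (Function.mulSupport x.1.left).Finite := x.2
    refine hbase hfin.toFinset _ (mul_inv_cancel x.1.right) fun k hk => ?_
    change x.1.left k * 1⁻¹ = 1
    rw [inv_one, mul_one]
    simpa using hk
  simpa using C.mul_mem hx (hK x.1.right)

variable {A : Finset H} {B : Finset K}

/-- Generators of the wreath product. -/
noncomputable def wreathGenerators (A : Finset H) (B : Finset K)
    [DecidableEq (restrictedWreathProduct H K)] : Finset (restrictedWreathProduct H K) :=
  A.image (wreathSingle K) ∪ B.image (wreathInl H)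

variable [DecidableEq (restrictedWreathProduct H K)]

theorem isSymmGenerating_wreathGenerators (hA : IsSymmGenerating A) (hB : IsSymmGenerating B) :
    IsSymmGenerating (wreathGenerators A B) where
  inv_mem x hx := by
    rcases Finset.mem_union.1 hx with hx | hx <;> obtain ⟨a, ha, rfl⟩ := Finset.mem_image.1 hx
    · exact Finset.mem_union_left _ (Finset.mem_image.2 ⟨a⁻¹, hA.inv_mem a ha, map_inv _ _⟩)
    · exact Finset.mem_union_right _ (Finset.mem_image.2 ⟨a⁻¹, hB.inv_mem a ha, map_inv _ _⟩)
  closure_eq_top := by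
    rw [wreathGenerators, Finset.coe_union, Finset.coe_image, Finset.coe_image]
    exact closure_wreath_eq_top hA.closure_eq_top hB.closure_eq_top

open Classical in
/-- The way in which the machine for the wreath product treats its input letters. -/
noncomputable def wreathAct (A : Finset H) (B : Finset K) (z : wreathGenerators A B) :
    Fin A.card ⊕ K :=
  -- The identity may arise from both generating sets; either reading is correct, as only the
  -- element represented matters.
  if h : ∃ i, z.1 = wreathSingle K (A.equivFin.symm i).1 then .inl h.choose else .inr z.1.1.right

theorem eq_of_wreathAct_eq_inl {z : wreathGenerators A B} {i : Fin A.card}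
    (h : wreathAct A B z = .inl i) : z.1 = wreathSingle K (A.equivFin.symm i).1 := by
  unfold wreathAct at h
  split_ifs at h with h'
  rw [Sum.inl.injEq] at h
  exact h ▸ h'.choose_spec

theorem eq_of_wreathAct_eq_inr {z : wreathGenerators A B} {g : K}
    (h : wreathAct A B z = .inr g) : z.1 = wreathInl H g := by
  unfold wreathAct at h
  split_ifs at h with h'
  rw [Sum.inr.injEq] at h
  rcases Finset.mem_union.1 z.2 with hz | hz <;> obtain ⟨a, ha, hz⟩ := Finset.mem_image.1 hz
  · exact absurd ⟨A.equivFin ⟨a, ha⟩, by simp [hz]⟩ h'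
  · rw [← hz] at h ⊢
    rw [← h]
    rfl

theorem FreeCosets.exists_bound (W : FreeCosets K) : ∃ N, ∀ (z : wreathGenerators A B) (g : K),
    wreathAct A B z = .inr g → ∀ t, (W.nf (g⁻¹ * W.nf.symm (t, 1))).2.toWord.length ≤ N := by
  obtain ⟨N, hN⟩ := (Set.finite_range fun x : wreathGenerators A B × W.T =>
    (W.nf (x.1.1.1.right⁻¹ * W.nf.symm (x.2, 1))).2.toWord.length).bddAbove
  refine ⟨N, fun z g hz t => hN ⟨(z, t), ?_⟩⟩
  have h := eq_of_wreathAct_eq_inr hz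
  dsimp only
  rw [h]
  rfl

/-- The data of the machine for the wreath product. -/
noncomputable def FreeCosets.wreathData (W : FreeCosets K) (A : Finset H) (B : Finset K) :
    WreathData (wreathGenerators A B) A K where
  toFreeCosets := W
  I := Fin A.card
  letter := A.equivFin.symm
  act := wreathAct A B
  N := (W.exists_bound (A := A) (B := B)).choose
  bound := (W.exists_bound (A := A) (B := B)).choose_spec

/-- Appending `g` multiplies the component in `K` on the right, hence its inverse, the position, by
`g⁻¹` on the left. A letter of `H` read at position `p` contributes to the coordinate at `p⁻¹`. -/
theorem prod_wreathGenerators (W : FreeCosets K) (w : List (wreathGenerators A B)) :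
    (w.map (fun a : wreathGenerators A B => (a : restrictedWreathProduct H K))).prod.1.right =
      ((W.wreathData A B).endPos 1 w)⁻¹ ∧
    ∀ k, (w.map (fun a : wreathGenerators A B => (a : restrictedWreathProduct H K))).prod.1.left k =
      (((W.wreathData A B).hitWord (· = k⁻¹) 1 w).map fun a : A => (a : H)).prod := by
  induction w using List.reverseRecOn with
  | nil =>
    refine ⟨?_, fun k => ?_⟩
    · simp [WreathData.endPos]
    · simp [WreathData.hitWord]
  | append_singleton w z ih =>
    obtain ⟨ih₁, ih₂⟩ := ih
    rw [List.map_append, List.prod_append, List.map_singleton, List.prod_singleton]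
    set y := (w.map (fun a : wreathGenerators A B => (a : restrictedWreathProduct H K))).prod
    have hr : (y * z.1).1.right = y.1.right * z.1.1.right := rfl
    have hl : ∀ k, (y * z.1).1.left k = y.1.left k * z.1.1.left (y.1.right⁻¹ * k) := fun _ => rfl
    simp only [hr, hl]
    cases hz : wreathAct A B z with
    | inl i =>
      have hz' : (W.wreathData A B).act z = .inl i := hz
      rw [WreathData.endPos_concat_inl hz', eq_of_wreathAct_eq_inl hz, wreathSingle_right, mul_one,
        wreathSingle_left]
      refine ⟨ih₁, fun k => ?_⟩
      rw [ih₁, ih₂, inv_inv]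
      by_cases h : (W.wreathData A B).endPos 1 w = k⁻¹
      · rw [WreathData.hitWord_concat_of_mem hz' h, h, inv_mul_cancel, Pi.mulSingle_eq_same,
          List.map_append, List.prod_append, List.map_singleton, List.prod_singleton]
        rfl
      · rw [WreathData.hitWord_concat_of_notMem hz' h, Pi.mulSingle_eq_of_ne, mul_one]
        rwa [ne_eq, mul_eq_one_iff_eq_inv]
    | inr g =>
      have hz' : (W.wreathData A B).act z = .inr g := hz
      rw [WreathData.endPos_concat_inr hz', eq_of_wreathAct_eq_inr hz, wreathInl_right,
        wreathInl_left, ih₁]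
      refine ⟨by simp, fun k => ?_⟩
      rw [WreathData.hitWord_concat_inr hz', ih₂]
      simp

theorem mem_coWordProblem_wreath (W : FreeCosets K) (w : List (wreathGenerators A B)) :
    w ∈ coWordProblem (wreathGenerators A B) ↔ (W.wreathData A B).endPos 1 w ≠ 1 ∨
      ∃ k, (((W.wreathData A B).hitWord (· = k) 1 w).map fun a : A => (a : H)).prod ≠ 1 := by
  change (w.map (fun a : wreathGenerators A B => (a : restrictedWreathProduct H K))).prod ≠ 1 ↔ _
  obtain ⟨h₁, h₂⟩ := prod_wreathGenerators W w
  rw [← not_iff_not, not_not, not_or, not_not, not_exists, Subtype.ext_iff,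
    RegularWreathProduct.ext_iff, and_comm, h₁]
  refine and_congr inv_eq_one ⟨fun h k => ?_, fun h => funext fun k => ?_⟩
  · have := congrFun h k⁻¹
    rw [h₂, inv_inv] at this
    exact not_not.2 this
  · rw [h₂]
    exact not_not.1 (h k⁻¹)

end Wreath

theorem mainTheorem5 {H : Type u} {K : Type v} [Group H] [Group K]
    (hH : IsSpecialCoET0L H) (hKfg : Group.FG K) (hK : IsVirtuallyFree K) :
    IsSpecialCoET0L (restrictedWreathProduct H K) ∧ IsCoET0L (restrictedWreathProduct H K) := by
  classical
  suffices h : IsSpecialCoET0L (restrictedWreathProduct H K) from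
    ⟨h, h.imp fun _ ⟨h₁, M, _, _, h₂⟩ => ⟨h₁, M, h₂⟩⟩
  obtain ⟨A, hA, M, R, hM, hL⟩ := hH
  obtain ⟨N, S, hN, hacc⟩ := (hL ▸ hM.isPre).exists_accept_subset hA.inv_mem
  obtain ⟨W⟩ := hK.exists_freeCosets hKfg
  obtain ⟨B, hB⟩ := Group.fg_def.1 hKfg
  have hB' : IsSymmGenerating (B ∪ B.image (·⁻¹)) := by
    refine ⟨fun b hb => ?_, top_le_iff.1 ?_⟩
    · rcases Finset.mem_union.1 hb with hb | hb
      · exact Finset.mem_union_right _ (Finset.mem_image_of_mem _ hb)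
      · obtain ⟨c, hc, rfl⟩ := Finset.mem_image.1 hb
        exact Finset.mem_union_left _ ((inv_inv c).symm ▸ hc)
    · rw [← hB]
      exact Subgroup.closure_mono (by simp)
  exact ⟨wreathGenerators A (B ∪ B.image (·⁻¹)), isSymmGenerating_wreathGenerators hA hB',
    (CSPDA.wreath_isPre (W := W.wreathData A (B ∪ B.image (·⁻¹))) hN hacc (fun _ => Iff.rfl)
      (mem_coWordProblem_wreath W)).isSpecialET0L⟩
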